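/- Let $(\mathcal E,\mathcal S)$ be a predicative category with small maps. That is, $\mathcal E$ is a positive Heyting category: it has finite limits, is regular, has stable disjoint finite sums, and for every $f:Y\to X$ the pullback map $f^*:\mathrm{Sub}(X)\to\mathrm{Sub}(Y)$ has a right adjoint $\forall_f$. Moreover $\mathcal S$ is a class of maps (the small maps) satisfying the following axioms: (A1) stability under pullback; (A2) descent along covers; (A3) closure under binary sums of maps; (A4) $0\to1$, $1\to1$ and $1+1\to1$ are small; (A5) closure under composition; (A6) if $gf$ is small and $f$ is a cover, then $g$ is small; (A7) collection: for every cover $p:Y\to X$ and small $f:X\to A$ there are a small $g:Z\to B$, a cover $h:B\to A$ and a map $z:Z\to Y$ such that $fpz=hg$ and the comparison map $Z\to B\times_A X$ is a cover; (A8) for small $f$, $\forall_f$ preserves small subobjects (those represented by small monos); (A9) all diagonals are small. In addition: small maps are exponentiable; the W-type of every small map exists; $\mathcal E$ has a natural numbers object $N$, and $N\to1$ is small; there is a universal small map $\pi:V\to U$, i.e. every small map is covered by a pullback of $\pi$; and bounded exactness holds: every equivalence relation given by a small mono has a stable quotient. Let $\mathcal C$ be an internal category in $\mathcal E$ whose codomain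 map $\mathcal C_1\to\mathcal C_0$ is small. A sieve on $a\in\mathcal C_0$ is a small collection of arrows with codomain $a$ closed under precomposition. Let $\mathrm{Cov}$ be an internal Grothendieck topology on $\mathcal C$, i.e. in the internal logic of $\mathcal E$ a collection $\mathrm{Cov}(a)$ of sieves on $a$ for every $a$ such that the maximal sieve is in $\mathrm{Cov}(a)$; if $S\in\mathrm{Cov}(a)$ and $f:b\to a$, then $f^*S\in\mathrm{Cov}(b)$; and if $S$ is a sieve on $a$ and $R\in\mathrm{Cov}(a)$ is such that $f^*S\in\mathrm{Cov}(b)$ for all $f:b\to a$ in $R$, then $S\in\mathrm{Cov}(a)$. Assume that the site is presentable: there are small collections $\mathrm{BCov}(a)$ of sieves on $a$, given internally as a function of $a\in\mathcal C_0$, such that a sieve $S$ on $a$ is in $\mathrm{Cov}(a)$ if and only if there is an $R\in\mathrm{BCov}(a)$ with $R\subseteq S$. Then the category $\mathrm{Psh}_{\mathcal E}(\mathcal C)$ of internal presheaves and its full subcategory $\mathrm{Sh}_{\mathcal E}(\mathcal C)$ of internal sheaves have finite limits, and the inclusion $i_*:\mathrm{Sh}_{\mathcal E}(\mathcal C)\to\mathrm{Psh}_{\mathcal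 E}(\mathcal C)$ has a left adjoint $i^*$ (sheafification) that is cartesian, i.e. preserves finite limits. -/

import Mathlib

open CategoryTheory CategoryTheory.Limits

universe v u

noncomputable section

namespace AST

section SmallMaps

/-- Positive Heyting categories: finite limits and regularity (`Regular`; covers are the regular
epimorphisms), finite sums that are stable (`FinitaryPreExtensive`) and disjoint, and a right
adjoint `∀_f` to pullback of subobjects along every morphism `f`. -/
class PositiveHeytingCategory (E : Type u) [Category.{v} E] : Prop where
  [regular : Regular E]
  [stableSums : FinitaryPreExtensive E]
  [disjointSums : BinaryCoproductsDisjoint E]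
  exists_forall : ∀ {Y X : E} (f : Y ⟶ X) (A : Subobject Y),
    ∃ B : Subobject X, ∀ D : Subobject X, (Subobject.pullback f).obj D ≤ A ↔ D ≤ B

attribute [instance] PositiveHeytingCategory.regular
attribute [instance] PositiveHeytingCategory.stableSums
attribute [instance] PositiveHeytingCategory.disjointSums

variable {E : Type u} [Category.{v} E]

/-- The commutative square with sides `top : D ⟶ B`, `left : D ⟶ C`, `right : B ⟶ A` and
`bottom : C ⟶ A` is a covering square: the comparison map `D ⟶ B ×_A C` and `bottom` are
covers. -/
def IsCoveringSquare [HasPullbacks E] {D B C A : E} (top : D ⟶ B) (left : D ⟶ C)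
    (right : B ⟶ A) (bottom : C ⟶ A) : Prop :=
  (∃ w : top ≫ right = left ≫ bottom, IsRegularEpi (pullback.lift top left w)) ∧
    IsRegularEpi bottom

/-- The axioms for a class of small maps. -/
structure IsClassOfSmallMaps [PositiveHeytingCategory E] (S : MorphismProperty E) : Prop where
  pullback_stable : S.IsStableUnderBaseChange
  descent : ∀ {D B C A : E} (t : D ⟶ B) (g : D ⟶ C) (f : B ⟶ A) (p : C ⟶ A),
    IsPullback t g f p → IsRegularEpi p → S g → S f
  sums : ∀ {X Y X' Y' : E} (f : X ⟶ Y) (f' : X' ⟶ Y'), S f → S f' → S (coprod.map f f')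
  empty_small : S (initial.to (⊤_ E))
  one_small : S (𝟙 (⊤_ E))
  two_small : S (terminal.from ((⊤_ E) ⨿ (⊤_ E)))
  composition : ∀ {X Y Z : E} (f : X ⟶ Y) (g : Y ⟶ Z), S f → S g → S (f ≫ g)
  quotients : ∀ {Z Y X : E} (f : Z ⟶ Y) (g : Y ⟶ X), IsRegularEpi f → S (f ≫ g) → S g
  collection : ∀ {Y X A : E} (p : Y ⟶ X) (f : X ⟶ A), IsRegularEpi p → S f →
    ∃ (Z B : E) (z : Z ⟶ Y) (g : Z ⟶ B) (h : B ⟶ A),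
      IsCoveringSquare (z ≫ p) g f h ∧ S g
  /-- If `f` is small and `A` is a bounded subobject, then `B = ∀_f A` is bounded. -/
  heyting : ∀ {Y X : E} (f : Y ⟶ X) (A : Subobject Y) (B : Subobject X),
    (∀ D : Subobject X, (Subobject.pullback f).obj D ≤ A ↔ D ≤ B) →
      S f → S A.arrow → S B.arrow
  diagonals : ∀ X : E, S (diag X)

/-- The polynomial functor `Σ_Y ∘ Π_f ∘ X^*` of an exponentiable map `f : X ⟶ Y`. -/
def polynomialFunctor [HasFiniteLimits E] {X Y : E} (f : X ⟶ Y)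
    [(Over.pullback f).IsLeftAdjoint] : E ⥤ E :=
  Over.star X ⋙ (Over.pullback f).rightAdjoint ⋙ Over.forget Y

/-- `(N, z, s)` is a natural numbers object. -/
def IsNaturalNumbersObject [HasFiniteLimits E] (N : E) (z : ⊤_ E ⟶ N) (s : N ⟶ N) : Prop :=
  ∀ (X : E) (x : ⊤_ E ⟶ X) (t : X ⟶ X), ∃! h : N ⟶ X, z ≫ h = x ∧ s ≫ h = h ≫ t

/-- The subobject `R` of `X × X` is an equivalence relation, in terms of generalised elements. -/
def IsEquivalenceRelation [HasFiniteLimits E] {X : E} (R : Subobject (X ⨯ X)) : Prop :=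
  ∀ T : E, Equivalence fun x y : T ⟶ X => R.Factors (prod.lift x y)

/-- `q : X ⟶ Q` is a stable quotient of `R`: the diagram `R ⇉ X ⟶ Q` is exact (`R` is the kernel
pair of `q`, and `q` is the coequalizer of `R`), and so is its pullback along any `P ⟶ Q`. (A
pullback of a kernel pair is a kernel pair, and a regular epimorphism is the coequalizer of its
kernel pair.) -/
def IsStableQuotient [HasFiniteLimits E] {X Q : E} (R : Subobject (X ⨯ X)) (q : X ⟶ Q) : Prop :=
  IsKernelPair q (R.arrow ≫ prod.fst) (R.arrow ≫ prod.snd) ∧ IsRegularEpi q ∧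
    ∀ {P : E} (p : P ⟶ Q), IsRegularEpi (pullback.snd q p)

/-- `(E, S)` is a predicative category with small maps. -/
structure IsPredicative [PositiveHeytingCategory E] (S : MorphismProperty E) : Prop
    extends IsClassOfSmallMaps S where
  exponentiable : ∀ {X Y : E} (f : X ⟶ Y), S f → (Over.pullback f).IsLeftAdjoint
  wTypes : ∀ {X Y : E} (f : X ⟶ Y) [(Over.pullback f).IsLeftAdjoint], S f →
    HasInitial (Endofunctor.Algebra (polynomialFunctor f))
  smallNaturalNumbers : ∃ (N : E) (z : ⊤_ E ⟶ N) (s : N ⟶ N),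
    IsNaturalNumbersObject N z s ∧ S (terminal.from N)
  representability : ∃ (V U : E) (π : V ⟶ U), S π ∧ ∀ {Y X : E} (f : Y ⟶ X), S f →
    ∃ (B A : E) (g : B ⟶ A) (b : B ⟶ Y) (a : A ⟶ X) (b' : B ⟶ V) (a' : A ⟶ U),
      IsCoveringSquare b g f a ∧ IsPullback b' g π a'
  boundedExactness : ∀ {X : E} (R : Subobject (X ⨯ X)), IsEquivalenceRelation R → S R.arrow →
    ∃ (Q : E) (q : X ⟶ Q), IsStableQuotient R q

end SmallMaps

section InternalPresheaves

variable {E : Type u} [Category.{v} E] [HasFiniteLimits E]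

variable (E) in
/-- The data of an internal category; `comp` sends `(f, g)` with `dom f = cod g` to `f ∘ g`. -/
structure InternalCategoryData where
  ob : E
  mor : E
  dom : mor ⟶ ob
  cod : mor ⟶ ob
  one : ob ⟶ mor
  comp : pullback dom cod ⟶ mor

/-- The composite `f ∘ g` of generalised arrows `f` and `g`. -/
def InternalCategoryData.compose (C : InternalCategoryData E) {T : E} (f g : T ⟶ C.mor)
    (h : f ≫ C.dom = g ≫ C.cod) : T ⟶ C.mor :=
  pullback.lift f g h ≫ C.comp

variable (E) in
/-- An internal category; the laws are stated for generalised elements. -/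
structure InternalCategory extends InternalCategoryData E where
  one_dom : one ≫ dom = 𝟙 ob
  one_cod : one ≫ cod = 𝟙 ob
  compose_dom : ∀ {T : E} (f g : T ⟶ mor) (h : f ≫ dom = g ≫ cod),
    toInternalCategoryData.compose f g h ≫ dom = g ≫ dom
  compose_cod : ∀ {T : E} (f g : T ⟶ mor) (h : f ≫ dom = g ≫ cod),
    toInternalCategoryData.compose f g h ≫ cod = f ≫ cod
  one_compose : ∀ {T : E} (g : T ⟶ mor),
    toInternalCategoryData.compose (g ≫ cod ≫ one) g
      (show (g ≫ cod ≫ one) ≫ dom = g ≫ cod by simp [one_dom]) = g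
  compose_one : ∀ {T : E} (f : T ⟶ mor),
    toInternalCategoryData.compose f (f ≫ dom ≫ one)
      (show f ≫ dom = (f ≫ dom ≫ one) ≫ cod by simp [one_cod]) = f
  assoc : ∀ {T : E} (f g k : T ⟶ mor) (h : f ≫ dom = g ≫ cod) (h' : g ≫ dom = k ≫ cod),
    toInternalCategoryData.compose (toInternalCategoryData.compose f g h) k
        (by rw [compose_dom, h']) =
      toInternalCategoryData.compose f (toInternalCategoryData.compose g k h')
        (by rw [compose_cod, h])

/-- The data of an internal presheaf: an object `σ : X ⟶ C₀` over the object of objects, and an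
action sending `(x, f)` with `σ x = cod f` to `x · f`. -/
structure PresheafData (C : InternalCategory E) where
  X : E
  σ : X ⟶ C.ob
  act : pullback σ C.cod ⟶ X

/-- The restriction `x · f` of a generalised element `x` along a generalised arrow `f`. -/
def PresheafData.res {C : InternalCategory E} (P : PresheafData C) {T : E} (x : T ⟶ P.X)
    (f : T ⟶ C.mor) (h : x ≫ P.σ = f ≫ C.cod) : T ⟶ P.X :=
  pullback.lift x f h ≫ P.act

/-- Internal presheaves on `C`. -/
structure Presheaf (C : InternalCategory E) extends PresheafData C where
  res_σ : ∀ {T : E} (x : T ⟶ X) (f : T ⟶ C.mor) (h : x ≫ σ = f ≫ C.cod),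
    toPresheafData.res x f h ≫ σ = f ≫ C.dom
  res_one : ∀ {T : E} (x : T ⟶ X),
    toPresheafData.res x (x ≫ σ ≫ C.one)
      (show x ≫ σ = (x ≫ σ ≫ C.one) ≫ C.cod by simp [C.one_cod]) = x
  res_compose : ∀ {T : E} (x : T ⟶ X) (f g : T ⟶ C.mor) (h : x ≫ σ = f ≫ C.cod)
    (h' : f ≫ C.dom = g ≫ C.cod),
    toPresheafData.res x (C.compose f g h') (by rw [C.compose_cod, h]) =
      toPresheafData.res (toPresheafData.res x f h) g (by rw [res_σ, h'])

/-- Morphisms of internal presheaves. -/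
@[ext]
structure Presheaf.Hom {C : InternalCategory E} (P Q : Presheaf C) where
  map : P.X ⟶ Q.X
  map_σ : map ≫ Q.σ = P.σ
  map_res : ∀ {T : E} (x : T ⟶ P.X) (f : T ⟶ C.mor) (h : x ≫ P.σ = f ≫ C.cod),
    P.res x f h ≫ map = Q.res (x ≫ map) f (by rw [Category.assoc, map_σ, h])

instance {C : InternalCategory E} : Category (Presheaf C) where
  Hom := Presheaf.Hom
  id P := ⟨𝟙 _, by simp, by simp⟩
  comp F G := ⟨F.map ≫ G.map, by simp [G.map_σ, F.map_σ], fun x f h => by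
    rw [← Category.assoc, F.map_res, G.map_res]; simp⟩
  id_comp F := Presheaf.Hom.ext (Category.id_comp F.map)
  comp_id F := Presheaf.Hom.ext (Category.comp_id F.map)
  assoc F G H := Presheaf.Hom.ext (Category.assoc F.map G.map H.map)

end InternalPresheaves

section InternalSheaves

variable {E : Type u} [Category.{v} E] [HasFiniteLimits E]

/-- The generalised arrow `f` belongs to the member `R_t` of the `T`-indexed family `R` of
subobjects of `C₁`, where `t` is a generalised element of `T`. -/
abbrev Mem {M T U : E} (R : Subobject (M ⨯ T)) (f : U ⟶ M) (t : U ⟶ T) : Prop :=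
  R.Factors (prod.lift f t)

/-- The `T`-indexed family `R` of subobjects of `C₁` is a family of (small) sieves on `a`, where
`a : T ⟶ C₀` is a `T`-indexed family of objects. -/
structure IsSieve (S : MorphismProperty E) {C : InternalCategory E} {T : E} (a : T ⟶ C.ob)
    (R : Subobject (C.mor ⨯ T)) : Prop where
  small : S (R.arrow ≫ prod.snd)
  cod_eq : ∀ {U : E} (f : U ⟶ C.mor) (t : U ⟶ T), Mem R f t → f ≫ C.cod = t ≫ a
  closed : ∀ {U : E} (f g : U ⟶ C.mor) (t : U ⟶ T) (h : f ≫ C.dom = g ≫ C.cod),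
    Mem R f t → Mem R (C.compose f g h) t

/-- An object `K ⟶ C₀` of sieves: a family of sieves indexed by `K` in which no sieve is repeated.
This is the same thing as a subobject `K` of the object of all pairs `(a, S)` with `S` a sieve
on `a`. -/
structure ObjectOfSieves (S : MorphismProperty E) (C : InternalCategory E) where
  K : E
  base : K ⟶ C.ob
  sieve : Subobject (C.mor ⨯ K)
  isSieve : IsSieve S base sieve
  injective : ∀ {T : E} (c d : T ⟶ K), c ≫ base = d ≫ base →
    (∀ {U : E} (t : U ⟶ T) (f : U ⟶ C.mor), Mem sieve f (t ≫ c) ↔ Mem sieve f (t ≫ d)) → c = d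

/-- A Grothendieck topology on `C`: an object `Cov = K` of covering sieves. The axioms are those
for a topology, read in the internal logic (in terms of generalised elements): `c : T ⟶ K` is a
`T`-indexed family of covering sieves, whose members are the `f` with `Mem sieve f (t ≫ c)`. -/
structure Topology (S : MorphismProperty E) (C : InternalCategory E)
    extends ObjectOfSieves S C where
  /-- The maximal sieve is covering. -/
  maximality : ∀ {T : E} (a : T ⟶ C.ob), ∃ c : T ⟶ K, c ≫ base = a ∧
    ∀ {U : E} (t : U ⟶ T) (f : U ⟶ C.mor), f ≫ C.cod = t ≫ a → Mem sieve f (t ≫ c)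
  /-- If `c` is covering, then so is `f^* c`. -/
  stability : ∀ {T : E} (c : T ⟶ K) (f : T ⟶ C.mor), f ≫ C.cod = c ≫ base →
    ∃ d : T ⟶ K, d ≫ base = f ≫ C.dom ∧
      ∀ {U : E} (t : U ⟶ T) (g : U ⟶ C.mor) (h : (t ≫ f) ≫ C.dom = g ≫ C.cod),
        Mem sieve g (t ≫ d) ↔ Mem sieve (C.compose (t ≫ f) g h) (t ≫ c)
  /-- If `r` is covering and `f^* R` is covering for all `f` in `r`, then `R` is covering. -/
  localCharacter : ∀ {T : E} (r : T ⟶ K) (R : Subobject (C.mor ⨯ T)),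
    IsSieve S (r ≫ base) R →
    (∀ {U : E} (t : U ⟶ T) (f : U ⟶ C.mor), Mem sieve f (t ≫ r) →
      ∃ d : U ⟶ K, d ≫ base = f ≫ C.dom ∧
        ∀ {V : E} (w : V ⟶ U) (g : V ⟶ C.mor) (h : (w ≫ f) ≫ C.dom = g ≫ C.cod),
          Mem sieve g (w ≫ d) ↔ Mem R (C.compose (w ≫ f) g h) (w ≫ t)) →
    ∃ c : T ⟶ K, c ≫ base = r ≫ base ∧
      ∀ {U : E} (t : U ⟶ T) (f : U ⟶ C.mor), Mem sieve f (t ≫ c) ↔ Mem R f t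

namespace Topology

variable {S : MorphismProperty E} {C : InternalCategory E} (J : Topology S C)

/-- `B` is a presentation for the site: a small collection `BCov(a)` of sieves for every `a`, such
that (in the internal logic) a sieve `R` on `a` is covering if and only if there is a basic
covering sieve in `BCov(a)` contained in `R`; existence in the internal logic is existence after
passing to a cover `p`. -/
structure IsPresentation (B : ObjectOfSieves S C) : Prop where
  small : S B.base
  covers_iff : ∀ {T : E} (a : T ⟶ C.ob) (R : Subobject (C.mor ⨯ T)), IsSieve S a R →
    ((∃ c : T ⟶ J.K, c ≫ J.base = a ∧
        ∀ {U : E} (t : U ⟶ T) (f : U ⟶ C.mor), Mem J.sieve f (t ≫ c) ↔ Mem R f t) ↔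
      ∃ (T' : E) (p : T' ⟶ T) (b : T' ⟶ B.K), IsRegularEpi p ∧ b ≫ B.base = p ≫ a ∧
        ∀ {U : E} (t : U ⟶ T') (f : U ⟶ C.mor), Mem B.sieve f (t ≫ b) → Mem R f (t ≫ p))

/-- The site is presentable. -/
def Presentable : Prop := ∃ B : ObjectOfSieves S C, J.IsPresentation B

/-- The object `{(f, t) | f ∈ c_t}` of all members of a family `c : T ⟶ Cov` of covering
sieves. -/
abbrev members {T : E} (c : T ⟶ J.K) : E := pullback (J.sieve.arrow ≫ prod.snd) c

/-- The arrow `f` in a member `(f, t)`. -/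
def arrow {T : E} (c : T ⟶ J.K) : J.members c ⟶ C.mor :=
  pullback.fst (J.sieve.arrow ≫ prod.snd) c ≫ J.sieve.arrow ≫ prod.fst

/-- The index `t` in a member `(f, t)`. -/
def index {T : E} (c : T ⟶ J.K) : J.members c ⟶ T :=
  pullback.snd (J.sieve.arrow ≫ prod.snd) c

theorem arrow_cod {T : E} (c : T ⟶ J.K) :
    J.arrow c ≫ C.cod = J.index c ≫ c ≫ J.base := by
  have e : prod.lift (J.sieve.arrow ≫ prod.fst) (J.sieve.arrow ≫ prod.snd) = J.sieve.arrow :=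
    Limits.prod.hom_ext (prod.lift_fst _ _) (prod.lift_snd _ _)
  have h := J.isSieve.cod_eq (J.sieve.arrow ≫ prod.fst) (J.sieve.arrow ≫ prod.snd)
    (by rw [Mem, e]; exact Subobject.factors_self _)
  have hc := pullback.condition (f := J.sieve.arrow ≫ prod.snd) (g := c)
  simp only [Category.assoc] at h hc
  simp only [arrow, index, Category.assoc]
  rw [h, reassoc_of% hc]

/-- A compatible family of elements of the presheaf `P` on the covering sieves `c`: an element
`x_f` of `P(dom f)` for every `f ∈ c`, such that `x_{fg} = x_f · g`. -/
structure IsCompatible (P : Presheaf C) {T : E} (c : T ⟶ J.K) (x : J.members c ⟶ P.X) : Prop where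
  σ_eq : x ≫ P.σ = J.arrow c ≫ C.dom
  compatible : ∀ {U : E} (m n : U ⟶ J.members c) (g : U ⟶ C.mor)
    (h : (m ≫ J.arrow c) ≫ C.dom = g ≫ C.cod), m ≫ J.index c = n ≫ J.index c →
    n ≫ J.arrow c = C.compose (m ≫ J.arrow c) g h →
    n ≫ x = P.res (m ≫ x) g (by rw [Category.assoc, σ_eq, ← Category.assoc, h])

/-- `P` is a sheaf: every compatible family `x` on a covering sieve `c` (on an object `a`) is
obtained by restriction from a unique element `z` of `P(a)`. -/
def IsSheaf : ObjectProperty (Presheaf C) := fun P =>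
  ∀ {T : E} (c : T ⟶ J.K) (x : J.members c ⟶ P.X), J.IsCompatible P c x →
    ∃! z : T ⟶ P.X, ∃ h : z ≫ P.σ = c ≫ J.base,
      P.res (J.index c ≫ z) (J.arrow c) (by rw [Category.assoc, h, J.arrow_cod]) = x

/-- The category of internal sheaves, a full subcategory of the category of presheaves. -/
abbrev Sheaf := J.IsSheaf.FullSubcategory

/-- The inclusion of sheaves in presheaves. -/
abbrev inclusion : J.Sheaf ⥤ Presheaf C := J.IsSheaf.ι

end Topology

end InternalSheaves

end AST

end

/-!
# Sheafification for internal sites in predicative categories with small maps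

An internal presheaf `P` on `C` is studied through its generalised elements. These form a presheaf
of sets `P.ext` on the total category `Tot C`, whose objects are the families `a : T ⟶ C.ob` of
objects of `C` and whose morphisms are reindexings together with families of arrows. The functor
`P ↦ P.ext` is fully faithful, and a presheaf `F` on `Tot C` is in its image as soon as it has a
universal family, one of which every family of elements is a reindexing in a unique way
(`Elem.IsUniversal.exists_presheaf`). Terminal presheaves and pullbacks have universal families, so
internal presheaves have finite limits, and these agree with the limits on `Tot C`
(`Presheaf.hasFiniteLimits_and_preserves`).

A presentation of the site gives a Grothendieck topology on `Tot C` in the ordinary sense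
(`siteTopology`): a sieve covers if, after passage to a cover of `E`, it contains locally all
members of a basic covering sieve. Local character of this topology is where collection is used. An
internal presheaf is an internal sheaf if and only if its presheaf of elements is a sheaf for this
topology (`isSheaf_of_isSheaf_ext`, `isSheaf_ext_of_isSheaf`). Ordinary sheafification over `Tot C`
is left exact and left adjoint to the inclusion, so everything reduces to showing that the sheaf `F`
associated to `P.ext` is again the presheaf of elements of an internal presheaf
(`exists_ext_iso_sheafify`).

A universal family of elements of `F` is built in two steps. Two elements of `P` become equal in
`F` if and only if they agree on some basic covering sieve. The collections of basic sieves, the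
sieves themselves and equality are small, so this is a bounded equivalence relation
(`isBounded_map_elem_eq`); bounded exactness provides its quotient `Q`, which represents the image
of `P` in `F`. This image generates `F`: an element of `F` is locally the amalgamation of a matching
family of elements of `Q` on a basic sieve. Small maps are exponentiable, so such matching families
form an object (`PresheafData.exists_object_of_matching`). Two of them have the same amalgamation if
and only if they agree on the intersection of their sieves, which is again a bounded equivalence
relation (`Elem.isBounded_res_eq`), and its quotient represents `F` (`Elem.exists_isUniversal`).
-/

noncomputable section

namespace AST

attribute [local simp] pullback.lift_fst pullback.lift_snd pullback.lift_fst_assoc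
  pullback.lift_snd_assoc prod.lift_fst prod.lift_snd prod.lift_fst_assoc prod.lift_snd_assoc

/-! ### Covers in a regular category -/

section Covers

variable {E : Type u} [Category.{v} E] [Regular E]

theorem isRegularEpi_comp {X Y Z : E} (f : X ⟶ Y) (g : Y ⟶ Z) (hf : IsRegularEpi f)
    (hg : IsRegularEpi g) : IsRegularEpi (f ≫ g) := by
  have : StrongEpi (f ≫ g) := strongEpi_comp f g
  infer_instance

/-- A generalised element of the codomain of a cover lifts after passing to a cover. -/
theorem exists_cover_lift {T' T U : E} (p : T' ⟶ T) (hp : IsRegularEpi p) (t : U ⟶ T) :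
    ∃ (V : E) (r : V ⟶ U) (w : V ⟶ T'), IsRegularEpi r ∧ w ≫ p = r ≫ t :=
  ⟨pullback t p, pullback.fst t p, pullback.snd t p, inferInstance, pullback.condition.symm⟩

omit [Regular E] in
/-- Covers are effective: a map that is constant on the fibres of a cover descends. -/
theorem exists_desc_of_cover {T' T X : E} (p : T' ⟶ T) (hp : IsRegularEpi p) (x : T' ⟶ X)
    (h : ∀ ⦃U : E⦄ (u w : U ⟶ T'), u ≫ p = w ≫ p → u ≫ x = w ≫ x) : ∃ z : T ⟶ X, p ≫ z = x :=
  ⟨_, IsRegularEpi.fac p x (h _ _ (IsRegularEpi.w p))⟩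

omit [Regular E] in
theorem eq_of_cover {T' T X : E} {p : T' ⟶ T} (hp : IsRegularEpi p) {x y : T ⟶ X}
    (h : p ≫ x = p ≫ y) : x = y :=
  (cancel_epi p).1 h

omit [Regular E] in
/-- Membership of a subobject is local for covers, because covers are strong epimorphisms. -/
theorem factors_of_cover {T' T Y : E} {p : T' ⟶ T} (hp : IsRegularEpi p) {A : Subobject Y}
    {t : T ⟶ Y} (h : A.Factors (p ≫ t)) : A.Factors t := by
  have sq : CommSq (A.factorThru _ h) p A.arrow t := ⟨by simp⟩
  rw [Subobject.factors_iff]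
  exact ⟨sq.lift, sq.fac_right⟩

omit [Regular E] in
theorem factors_comp {Y U V : E} {A : Subobject Y} (r : V ⟶ U) {t : U ⟶ Y} (h : A.Factors t) :
    A.Factors (r ≫ t) :=
  Subobject.factors_of_factors_right r h

theorem factors_pullback_iff {X Y U : E} (f : X ⟶ Y) (A : Subobject Y) (t : U ⟶ X) :
    ((Subobject.pullback f).obj A).Factors t ↔ A.Factors (t ≫ f) := by
  rw [Subobject.factors_iff, Subobject.factors_iff]
  have pb := Subobject.isPullback f A
  constructor
  · rintro ⟨k, rfl⟩
    exact ⟨k ≫ Subobject.pullbackπ f A, (Category.assoc _ _ _).trans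
      ((congrArg (k ≫ ·) pb.w).trans (Category.assoc _ _ _).symm)⟩
  · rintro ⟨k, hk⟩
    exact ⟨pb.lift k t hk, pb.lift_snd _ _ _⟩

omit [Regular E] in
theorem mk_factors_iff_exists {X Y U : E} (m : X ⟶ Y) [Mono m] (t : U ⟶ Y) :
    (Subobject.mk m).Factors t ↔ ∃ k : U ⟶ X, k ≫ m = t :=
  Subobject.mk_factors_iff _ _

theorem exists_image {X Y : E} (f : X ⟶ Y) :
    ∃ (I : E) (e : X ⟶ I) (m : I ⟶ Y), IsRegularEpi e ∧ Mono m ∧ e ≫ m = f :=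
  ⟨_, (Regular.strongEpiMonoFactorisation f).e, (Regular.strongEpiMonoFactorisation f).m,
    inferInstance, inferInstance, by simp⟩

end Covers

/-! ### Small maps and bounded predicates -/

section Bounded

variable {E : Type u} [Category.{v} E] [PositiveHeytingCategory E]

/-- Universal quantification along `f`, in terms of generalised elements. It is bounded when `f`
and the subobject quantified over are. -/
theorem exists_forall_factors {Z Y : E} (f : Z ⟶ Y) (A : Subobject Z) :
    ∃ B : Subobject Y, (∀ D : Subobject Y, (Subobject.pullback f).obj D ≤ A ↔ D ≤ B) ∧
      ∀ ⦃U : E⦄ (t : U ⟶ Y), B.Factors t ↔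
        ∀ ⦃V : E⦄ (r : V ⟶ U) (z : V ⟶ Z), z ≫ f = r ≫ t → A.Factors z := by
  obtain ⟨B, hB⟩ := PositiveHeytingCategory.exists_forall f A
  refine ⟨B, hB, fun U t => ⟨fun h V r z hz => ?_, fun h => ?_⟩⟩
  · have h1 : (Subobject.pullback f).obj B ≤ A := (hB B).2 le_rfl
    refine Subobject.factors_of_le _ h1 ?_
    have pb := Subobject.isPullback f B
    rw [Subobject.factors_iff]
    exact ⟨pb.lift (B.factorThru _ (factors_comp r h)) z (by simp [hz]), pb.lift_snd _ _ _⟩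
  · -- It suffices to treat the image of `t`.
    obtain ⟨I, e, m, he, hm, rfl⟩ := exists_image t
    have key : (Subobject.pullback f).obj (Subobject.mk m) ≤ A := by
      apply Subobject.le_of_factors
      have pb := Subobject.isPullback f (Subobject.mk m)
      obtain ⟨V, r, w, hr, hw⟩ := exists_cover_lift e he
        (Subobject.pullbackπ f (Subobject.mk m) ≫ (Subobject.underlyingIso m).hom)
      refine factors_of_cover hr (h w _ ?_)
      rw [Category.assoc, ← pb.w, reassoc_of% hw]
      simp
    have h2 := (hB _).1 key
    exact factors_comp e (Subobject.factors_of_le _ h2 (Subobject.mk_factors_self m))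

variable {S : MorphismProperty E} (hS : IsClassOfSmallMaps S)

include hS

namespace IsClassOfSmallMaps

theorem of_isPullback {P X Y Z : E} {fst : P ⟶ X} {snd : P ⟶ Y} {f : X ⟶ Z} {g : Y ⟶ Z}
    (h : IsPullback fst snd f g) (hg : S g) : S fst :=
  hS.pullback_stable.of_isPullback h.flip hg

theorem pullback_fst {X Y Z : E} (f : X ⟶ Z) (g : Y ⟶ Z) (hg : S g) : S (pullback.fst f g) :=
  hS.of_isPullback (.of_hasPullback f g) hg

theorem pullback_snd {X Y Z : E} (f : X ⟶ Z) (g : Y ⟶ Z) (hf : S f) : S (pullback.snd f g) :=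
  hS.of_isPullback (IsPullback.of_hasPullback f g).flip hf

theorem iso {X Y : E} (f : X ⟶ Y) [IsIso f] : S f :=
  hS.of_isPullback (snd := terminal.from X) (f := terminal.from Y) (g := 𝟙 _)
    (IsPullback.of_horiz_isIso ⟨terminal.hom_ext _ _⟩) hS.one_small

/-- A map that becomes small after composing with some map is small: all diagonals are small. -/
theorem of_comp {X Y Z : E} (f : X ⟶ Y) (g : Y ⟶ Z) (h : S (f ≫ g)) : S f := by
  have e : f = pullback.lift (𝟙 X) f (by simp) ≫ pullback.snd (f ≫ g) g := by simp
  rw [e]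
  refine hS.composition _ _ ?_ (hS.pullback_snd _ _ h)
  -- The graph of `f` is a pullback of the diagonal of `Y`.
  refine hS.of_isPullback (snd := f)
    (f := prod.lift (pullback.fst (f ≫ g) g ≫ f) (pullback.snd (f ≫ g) g)) (g := diag Y) ?_
    (hS.diagonals Y)
  refine ⟨⟨?_⟩, ⟨PullbackCone.IsLimit.mk _ (fun s => s.fst ≫ pullback.fst _ _) ?_ ?_ ?_⟩⟩
  · ext <;> simp
  · intro s
    have h := s.condition
    have h1 := h =≫ prod.fst
    have h2 := h =≫ prod.snd
    simp only [Category.assoc, prod.lift_fst, prod.lift_snd, Category.comp_id] at h1 h2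
    ext
    · simp
    · simp [h1, h2]
  · intro s
    have h := s.condition
    have h1 := h =≫ prod.fst
    simpa using h1
  · intro s m hm _
    rw [← hm]
    simp

theorem pullback_arrow {X Y : E} (f : X ⟶ Y) (A : Subobject Y) (hA : S A.arrow) :
    S ((Subobject.pullback f).obj A).arrow :=
  hS.of_isPullback (Subobject.isPullback f A).flip hA

end IsClassOfSmallMaps

omit hS

variable (S) in
/-- A predicate `φ` on the generalised elements of `Y` is bounded if it is membership of a
subobject whose inclusion is small. -/
def IsBounded {Y : E} (φ : ∀ ⦃U : E⦄, (U ⟶ Y) → Prop) : Prop :=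
  ∃ A : Subobject Y, S A.arrow ∧ ∀ ⦃U : E⦄ (t : U ⟶ Y), A.Factors t ↔ φ t

namespace IsBounded

omit [PositiveHeytingCategory E] in
theorem congr {Y : E} {φ ψ : ∀ ⦃U : E⦄, (U ⟶ Y) → Prop} (h : IsBounded S φ)
    (e : ∀ ⦃U : E⦄ (t : U ⟶ Y), φ t ↔ ψ t) : IsBounded S ψ := by
  obtain ⟨A, hA, h⟩ := h
  exact ⟨A, hA, fun U t => (h t).trans (e t)⟩

include hS

theorem of_mono {X Y : E} (m : X ⟶ Y) [Mono m] (hm : S m) :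
    IsBounded S fun U (t : U ⟶ Y) => ∃ k : U ⟶ X, k ≫ m = t := by
  refine ⟨Subobject.mk m, ?_, fun U t => Subobject.mk_factors_iff _ _⟩
  rw [← Subobject.underlyingIso_hom_comp_eq_mk]
  exact hS.composition _ _ (hS.iso _) hm

theorem precomp {X Y : E} {φ : ∀ ⦃U : E⦄, (U ⟶ Y) → Prop} (h : IsBounded S φ) (f : X ⟶ Y) :
    IsBounded S fun U (t : U ⟶ X) => φ (t ≫ f) := by
  obtain ⟨A, hA, h⟩ := h
  refine ⟨(Subobject.pullback f).obj A, hS.pullback_arrow f A hA, fun U t =>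
    (factors_pullback_iff f A t).trans (h _)⟩

theorem eq {Y Z : E} (f g : Y ⟶ Z) : IsBounded S fun U (t : U ⟶ Y) => t ≫ f = t ≫ g := by
  refine ((of_mono hS (diag Z) (hS.diagonals Z)).precomp hS (prod.lift f g)).congr fun U t => ?_
  constructor
  · rintro ⟨k, hk⟩
    have h1 := hk =≫ prod.fst
    have h2 := hk =≫ prod.snd
    simp only [Category.assoc, prod.lift_fst, prod.lift_snd, Category.comp_id] at h1 h2
    rw [← h1, ← h2]
  · intro h
    exact ⟨t ≫ f, by ext <;> simp [h]⟩

/-- Universal quantification along a small map. -/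
theorem all {Z Y : E} {φ : ∀ ⦃U : E⦄, (U ⟶ Z) → Prop} (h : IsBounded S φ) (f : Z ⟶ Y) (hf : S f) :
    IsBounded S fun U (t : U ⟶ Y) => ∀ ⦃V : E⦄ (r : V ⟶ U) (z : V ⟶ Z), z ≫ f = r ≫ t → φ z := by
  obtain ⟨A, hA, h⟩ := h
  obtain ⟨B, hB, h'⟩ := exists_forall_factors f A
  exact ⟨B, hS.heyting f A B hB hf hA, fun U t => by simp only [h', h]⟩

/-- Existential quantification along a small map; existence is existence on a cover. -/
theorem ex {Z Y : E} {φ : ∀ ⦃U : E⦄, (U ⟶ Z) → Prop} (h : IsBounded S φ) (f : Z ⟶ Y) (hf : S f) :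
    IsBounded S fun U (t : U ⟶ Y) =>
      ∃ (V : E) (r : V ⟶ U) (z : V ⟶ Z), IsRegularEpi r ∧ z ≫ f = r ≫ t ∧ φ z := by
  obtain ⟨A, hA, h⟩ := h
  obtain ⟨I, e, m, he, hm, hem⟩ := exists_image (A.arrow ≫ f)
  have hm' : S m := hS.quotients e m he (hem ▸ hS.composition _ _ hA hf)
  refine (of_mono hS m hm').congr fun U t => ⟨?_, ?_⟩
  · rintro ⟨k, rfl⟩
    obtain ⟨V, r, w, hr, hw⟩ := exists_cover_lift e he k
    refine ⟨V, r, w ≫ A.arrow, hr, by rw [Category.assoc, ← hem, reassoc_of% hw], ?_⟩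
    exact (h _).1 (Subobject.factors_comp_arrow w)
  · rintro ⟨V, r, z, hr, hz, hφ⟩
    refine (mk_factors_iff_exists m t).1
      (factors_of_cover hr ((mk_factors_iff_exists _ _).2 ⟨A.factorThru z ((h z).2 hφ) ≫ e, ?_⟩))
    rw [Category.assoc, hem, ← hz, Subobject.factorThru_arrow_assoc]

theorem and {Y : E} {φ ψ : ∀ ⦃U : E⦄, (U ⟶ Y) → Prop} (hφ : IsBounded S φ) (hψ : IsBounded S ψ) :
    IsBounded S fun U (t : U ⟶ Y) => φ t ∧ ψ t := by
  obtain ⟨A, hA, h⟩ := hφ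
  obtain ⟨B, hB, h'⟩ := hψ
  refine ⟨A ⊓ B, ?_, fun U t => by rw [Subobject.inf_factors, h, h']⟩
  rw [← Subobject.inf_comp_left]
  exact hS.composition _ _ (hS.of_isPullback (Subobject.inf_isPullback A B) hB) hA

/-- The image of a bounded subobject under a small mono. -/
theorem map {Z Y : E} {φ : ∀ ⦃U : E⦄, (U ⟶ Z) → Prop} (h : IsBounded S φ) (m : Z ⟶ Y) [Mono m]
    (hm : S m) : IsBounded S fun U (t : U ⟶ Y) => ∃ z : U ⟶ Z, z ≫ m = t ∧ φ z := by
  obtain ⟨A, hA, h⟩ := h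
  refine (of_mono hS (A.arrow ≫ m) (hS.composition _ _ hA hm)).congr fun U t => ⟨?_, ?_⟩
  · rintro ⟨k, rfl⟩
    exact ⟨k ≫ A.arrow, by simp, (h _).1 (Subobject.factors_comp_arrow k)⟩
  · rintro ⟨z, rfl, hz⟩
    exact ⟨A.factorThru z ((h z).2 hz), by simp⟩

end IsBounded

end Bounded

/-! ### The total category of an internal category -/

section Total

variable {E : Type u} [Category.{v} E] [HasFiniteLimits E]

namespace InternalCategory

variable (C : InternalCategory E)

theorem comp_compose {T U : E} (t : U ⟶ T) (f g : T ⟶ C.mor) (h : f ≫ C.dom = g ≫ C.cod) :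
    t ≫ C.compose f g h = C.compose (t ≫ f) (t ≫ g) (by simp [h]) := by
  simp only [InternalCategoryData.compose, ← Category.assoc]
  congr 1
  ext <;> simp

theorem compose_congr {T : E} {f f' g g' : T ⟶ C.mor} (hf : f = f') (hg : g = g')
    (h : f ≫ C.dom = g ≫ C.cod) :
    C.compose f g h = C.compose f' g' (by rw [← hf, ← hg, h]) := by
  subst hf hg
  rfl

theorem one_compose' {T : E} (g e : T ⟶ C.mor) (he : e = g ≫ C.cod ≫ C.one)
    (h : e ≫ C.dom = g ≫ C.cod) : C.compose e g h = g := by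
  subst he
  exact C.one_compose g

theorem compose_one' {T : E} (f e : T ⟶ C.mor) (he : e = f ≫ C.dom ≫ C.one)
    (h : f ≫ C.dom = e ≫ C.cod) : C.compose f e h = f := by
  subst he
  exact C.compose_one f

end InternalCategory

attribute [local simp] InternalCategory.compose_dom InternalCategory.compose_cod
  InternalCategory.one_dom InternalCategory.one_cod

namespace PresheafData

variable {C : InternalCategory E} (P : PresheafData C)

theorem comp_res {T U : E} (t : U ⟶ T) (x : T ⟶ P.X) (f : T ⟶ C.mor)
    (h : x ≫ P.σ = f ≫ C.cod) :
    t ≫ P.res x f h = P.res (t ≫ x) (t ≫ f) (by simp [h]) := by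
  simp only [PresheafData.res, ← Category.assoc]
  congr 1
  ext <;> simp

theorem res_congr {T : E} {x x' : T ⟶ P.X} {f f' : T ⟶ C.mor} (hx : x = x') (hf : f = f')
    (h : x ≫ P.σ = f ≫ C.cod) : P.res x f h = P.res x' f' (by rw [← hx, ← hf, h]) := by
  subst hx hf
  rfl

end PresheafData

theorem Presheaf.res_one' {C : InternalCategory E} (P : Presheaf C) {T : E} (x : T ⟶ P.X)
    (e : T ⟶ C.mor) (he : e = x ≫ P.σ ≫ C.one) (h : x ≫ P.σ = e ≫ C.cod) : P.res x e h = x := by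
  subst he
  exact P.res_one x

/-- The total category of the internal category `C`, that is of the indexed category
`T ↦ Hom(T, C)`: its objects are the families of objects of `C` indexed by an object of `E`. -/
structure Tot (C : InternalCategory E) where
  base : E
  ob : base ⟶ C.ob

namespace Tot

variable {C : InternalCategory E}

/-- A morphism of families: a reindexing `base` and a family of arrows of `C` over it. -/
@[ext]
structure Hom (X Y : Tot C) where
  base : X.base ⟶ Y.base
  arr : X.base ⟶ C.mor
  arr_dom : arr ≫ C.dom = X.ob
  arr_cod : arr ≫ C.cod = base ≫ Y.ob

attribute [local simp] Hom.arr_dom Hom.arr_cod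

instance : Category (Tot C) where
  Hom := Hom
  id X := ⟨𝟙 _, X.ob ≫ C.one, by simp, by simp⟩
  comp F G := ⟨F.base ≫ G.base, C.compose (F.base ≫ G.arr) F.arr (by simp), by simp, by simp⟩
  id_comp F := Hom.ext (Category.id_comp _)
    ((C.compose_congr (Category.id_comp _) rfl _).trans
      (C.compose_one' _ _ (by simp [← Category.assoc]) _))
  comp_id F := Hom.ext (Category.comp_id _) (C.one_compose' _ _ (by simp [← Category.assoc]) _)
  assoc F G H := by
    refine Hom.ext (Category.assoc _ _ _) ?_
    dsimp only
    rw [C.compose_congr (C.comp_compose _ _ _ _) rfl, ← C.assoc _ _ _ (by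
      simp only [Category.assoc, H.arr_dom, G.arr_cod]) _]
    exact C.compose_congr (C.compose_congr (Category.assoc _ _ _) rfl _) rfl _

/-- The morphism of the total category given by a reindexing and a family of arrows. -/
def mk' {T U : E} {a : T ⟶ C.ob} {b : U ⟶ C.ob} (u : U ⟶ T) (f : U ⟶ C.mor) (hd : f ≫ C.dom = b)
    (hc : f ≫ C.cod = u ≫ a) : (⟨U, b⟩ : Tot C) ⟶ ⟨T, a⟩ :=
  ⟨u, f, hd, hc⟩

/-- The cartesian morphism over a reindexing. -/
def cart {T U : E} (a : T ⟶ C.ob) (u : U ⟶ T) : (⟨U, u ≫ a⟩ : Tot C) ⟶ ⟨T, a⟩ :=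
  mk' u (u ≫ a ≫ C.one) (by simp) (by simp)

end Tot

open Opposite

universe w

/-! ### Families of elements of a presheaf on the total category -/

/-- A `T`-indexed family of elements of a presheaf on the total category. -/
structure Elem {C : InternalCategory E} (F : (Tot C)ᵒᵖ ⥤ Type w) (T : E) where
  ob : T ⟶ C.ob
  val : F.obj (op ⟨T, ob⟩)

namespace Elem

variable {C : InternalCategory E} {F G : (Tot C)ᵒᵖ ⥤ Type w} {T U V : E}

/-- The restriction of a family of elements along a morphism of the total category. -/
def along (s : Elem F T) {b : U ⟶ C.ob} (k : (⟨U, b⟩ : Tot C) ⟶ ⟨T, s.ob⟩) : Elem F U :=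
  ⟨b, F.map k.op s.val⟩

/-- The reindexing of a family of elements. -/
def res (s : Elem F T) (u : U ⟶ T) : Elem F U := s.along (Tot.cart s.ob u)

/-- The restriction of a family of elements along a family of arrows. -/
def pull (s : Elem F T) (u : U ⟶ T) (f : U ⟶ C.mor) (h : f ≫ C.cod = u ≫ s.ob) : Elem F U :=
  s.along (Tot.mk' u f rfl h)

/-- The image of a family of elements under a morphism of presheaves. -/
def map (φ : F ⟶ G) (s : Elem F T) : Elem G T := ⟨s.ob, φ.app _ s.val⟩

@[simp] theorem res_ob (s : Elem F T) (u : U ⟶ T) : (s.res u).ob = u ≫ s.ob := rfl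
@[simp] theorem map_ob (φ : F ⟶ G) (s : Elem F T) : (s.map φ).ob = s.ob := rfl

theorem mk_inj {a : T ⟶ C.ob} {x y : F.obj (op ⟨T, a⟩)} :
    (⟨a, x⟩ : Elem F T) = ⟨a, y⟩ ↔ x = y := by
  constructor
  · intro h
    injection h
  · rintro rfl
    rfl

theorem along_congr (s : Elem F T) {b b' : U ⟶ C.ob} (k : (⟨U, b⟩ : Tot C) ⟶ ⟨T, s.ob⟩)
    (k' : (⟨U, b'⟩ : Tot C) ⟶ ⟨T, s.ob⟩) (h : k.base = k'.base) (h' : k.arr = k'.arr) :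
    s.along k = s.along k' := by
  obtain rfl : b = b' := k.arr_dom.symm.trans ((h' =≫ C.dom).trans k'.arr_dom)
  obtain rfl : k = k' := Tot.Hom.ext h h'
  rfl

theorem along_along (s : Elem F T) {b : U ⟶ C.ob} (k : (⟨U, b⟩ : Tot C) ⟶ ⟨T, s.ob⟩)
    {c : V ⟶ C.ob} (l : (⟨V, c⟩ : Tot C) ⟶ ⟨U, b⟩) :
    Elem.along (s.along k) l = s.along (l ≫ k) :=
  mk_inj.2 (Functor.map_comp_apply F k.op l.op s.val).symm

theorem along_eq_pull (s : Elem F T) {b : U ⟶ C.ob} (k : (⟨U, b⟩ : Tot C) ⟶ ⟨T, s.ob⟩) :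
    s.along k = s.pull k.base k.arr k.arr_cod :=
  along_congr _ _ _ rfl rfl

theorem pull_congr {s s' : Elem F T} {u u' : U ⟶ T} {f f' : U ⟶ C.mor} (hs : s = s') (hu : u = u')
    (hf : f = f') (h : f ≫ C.cod = u ≫ s.ob) :
    s.pull u f h = s'.pull u' f' (by rw [← hs, ← hu, ← hf, h]) := by
  subst hs hu hf
  rfl

theorem res_eq_pull (s : Elem F T) (u : U ⟶ T) :
    s.res u = s.pull u (u ≫ s.ob ≫ C.one) (by simp) :=
  along_eq_pull _ _

theorem pull_eq_res (s : Elem F T) (u : U ⟶ T) (f : U ⟶ C.mor) (hf : f = u ≫ s.ob ≫ C.one)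
    (h : f ≫ C.cod = u ≫ s.ob) : s.pull u f h = s.res u := by
  subst hf
  exact (res_eq_pull s u).symm

theorem pull_pull (s : Elem F T) (u : U ⟶ T) (f : U ⟶ C.mor) (h) (v : V ⟶ U) (g : V ⟶ C.mor)
    (h' : g ≫ C.cod = v ≫ f ≫ C.dom) :
    (s.pull u f h).pull v g h' =
      s.pull (v ≫ u) (C.compose (v ≫ f) g (by simp [h'])) (by simp [h]) :=
  (along_along _ _ _).trans (along_congr _ _ _ rfl rfl)

theorem res_pull (s : Elem F T) (v : U ⟶ T) (u : V ⟶ U) (f : V ⟶ C.mor)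
    (h : f ≫ C.cod = u ≫ v ≫ s.ob) : (s.res v).pull u f h = s.pull (u ≫ v) f (by simp [h]) :=
  (along_along _ _ _).trans (along_congr _ _ _ rfl (C.one_compose' _ _ (by
    show u ≫ v ≫ s.ob ≫ C.one = f ≫ C.cod ≫ C.one
    rw [reassoc_of% h]) _))

theorem pull_res (s : Elem F T) (u : U ⟶ T) (f : U ⟶ C.mor) (h) (v : V ⟶ U) :
    (s.pull u f h).res v = s.pull (v ≫ u) (v ≫ f) (by simp [h]) :=
  (along_along _ _ _).trans (along_congr _ _ _ rfl (C.compose_one' _ _ (by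
    show v ≫ (f ≫ C.dom) ≫ C.one = (v ≫ f) ≫ C.dom ≫ C.one
    simp) _))

theorem res_res (s : Elem F T) (u : U ⟶ T) (v : V ⟶ U) : (s.res u).res v = s.res (v ≫ u) := by
  rw [res_eq_pull s u, pull_res, pull_eq_res]
  simp

theorem map_res (φ : F ⟶ G) (s : Elem F T) (u : U ⟶ T) : (s.map φ).res u = (s.res u).map φ :=
  mk_inj.2 (NatTrans.naturality_apply φ _ _).symm

theorem map_pull (φ : F ⟶ G) (s : Elem F T) (u : U ⟶ T) (f : U ⟶ C.mor) (h) :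
    (s.map φ).pull u f h = (s.pull u f h).map φ :=
  mk_inj.2 (NatTrans.naturality_apply φ _ _).symm

theorem map_map {H : (Tot C)ᵒᵖ ⥤ Type w} (φ : F ⟶ G) (ψ : G ⟶ H) (s : Elem F T) :
    (s.map φ).map ψ = s.map (φ ≫ ψ) :=
  rfl

end Elem

/-! ### Internal presheaves as presheaves on the total category -/

namespace Presheaf

variable {C : InternalCategory E}

/-- A family of elements of an internal presheaf over a given family of objects. (The universe is
raised, because sheafification over the total category lives in that universe.) -/
@[ext]
structure Section (P : Presheaf C) (X : Tot C) : Type (max u v) where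
  elt : X.base ⟶ P.X
  elt_σ : elt ≫ P.σ = X.ob

/-- The presheaf on the total category given by the families of elements of an internal
presheaf. -/
def ext (P : Presheaf C) : (Tot C)ᵒᵖ ⥤ Type (max u v) where
  obj X := P.Section X.unop
  map {X Y} k := TypeCat.ofHom fun (z : P.Section X.unop) =>
    (⟨P.res (k.unop.base ≫ z.elt) k.unop.arr
      (by rw [Category.assoc, z.elt_σ, k.unop.arr_cod]), by rw [P.res_σ, k.unop.arr_dom]⟩ :
      P.Section Y.unop)
  map_id X := by
    ext (z : P.Section _)
    exact (P.res_congr (Category.id_comp _) rfl _).trans (P.res_one' _ _ (by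
      rw [← Category.assoc, z.elt_σ]; rfl) _)
  map_comp {X Y Z} k l := by
    ext (z : P.Section _)
    show P.res ((l.unop.base ≫ k.unop.base) ≫ z.elt) (C.compose _ _ _) _ =
      P.res (l.unop.base ≫ P.res _ _ _) _ _
    rw [P.res_congr (P.comp_res _ _ _ _) rfl, ← P.res_compose _ _ _ _
      (by simp [l.unop.arr_cod, k.unop.arr_dom])]
    exact P.res_congr (Category.assoc _ _ _) rfl _

/-- The action of a morphism of internal presheaves on families of elements. -/
def Hom.toExt {P Q : Presheaf C} (g : P ⟶ Q) : P.ext ⟶ Q.ext where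
  app X := TypeCat.ofHom fun (z : P.Section X.unop) =>
    (⟨z.elt ≫ g.map, by rw [Category.assoc, g.map_σ, z.elt_σ]⟩ : Q.Section X.unop)
  naturality X Y k := by
    ext (z : P.Section _)
    refine Section.ext ?_
    exact (g.map_res _ _ _).trans (Q.res_congr (Category.assoc _ _ _) rfl _)

variable (C) in
/-- Internal presheaves as presheaves on the total category. -/
def extFunctor : Presheaf C ⥤ (Tot C)ᵒᵖ ⥤ Type (max u v) where
  obj P := P.ext
  map g := Hom.toExt g
  map_id P := by
    ext X (z : P.Section _)
    exact Section.ext (Category.comp_id _)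
  map_comp {P _ _} F G := by
    ext X (z : P.Section _)
    exact Section.ext (Category.assoc _ _ _).symm

/-- A generalised element of an internal presheaf, as a family of elements. -/
def elem (P : Presheaf C) {T : E} (z : T ⟶ P.X) : Elem P.ext T :=
  ⟨z ≫ P.σ, (⟨z, rfl⟩ : P.Section _)⟩

@[simp] theorem elem_ob (P : Presheaf C) {T : E} (z : T ⟶ P.X) : (P.elem z).ob = z ≫ P.σ := rfl

theorem elem_injective (P : Presheaf C) {T : E} {z z' : T ⟶ P.X} (h : P.elem z = P.elem z') :
    z = z' := by
  have key : ∀ s s' : Elem P.ext T, s = s' →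
      (show P.Section _ from s.val).elt = (show P.Section _ from s'.val).elt := by
    rintro s _ rfl
    rfl
  exact key _ _ h

theorem mk_eq_elem (P : Presheaf C) {T : E} (a : T ⟶ C.ob) (z : P.Section ⟨T, a⟩) :
    (⟨a, z⟩ : Elem P.ext T) = P.elem z.elt := by
  obtain ⟨z, hz⟩ := z
  dsimp at z hz
  subst hz
  rfl

theorem exists_elem (P : Presheaf C) {T : E} (s : Elem P.ext T) : ∃ z, s = P.elem z :=
  ⟨_, mk_eq_elem P _ _⟩

theorem elem_pull (P : Presheaf C) {T U : E} (z : T ⟶ P.X) (u : U ⟶ T) (f : U ⟶ C.mor)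
    (h : f ≫ C.cod = u ≫ (P.elem z).ob) :
    (P.elem z).pull u f h = P.elem (P.res (u ≫ z) f (by simp [h])) :=
  mk_eq_elem P _ ((P.ext.map (Tot.mk' u f rfl h).op) (⟨z, rfl⟩ : P.Section ⟨T, z ≫ P.σ⟩))

theorem elem_res (P : Presheaf C) {T U : E} (z : T ⟶ P.X) (u : U ⟶ T) :
    (P.elem z).res u = P.elem (u ≫ z) := by
  rw [Elem.res_eq_pull, elem_pull]
  exact congrArg _ (P.res_one' _ _ (by simp) _)

/-- Every family of elements of `P` is a reindexing of the generic one, so a morphism out of `P.ext`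
is determined by the image of the generic family. -/
theorem map_elem {P : Presheaf C} {F : (Tot C)ᵒᵖ ⥤ Type (max u v)} (φ : P.ext ⟶ F) {T : E}
    (z : T ⟶ P.X) : (P.elem z).map φ = ((P.elem (𝟙 P.X)).map φ).res z := by
  rw [Elem.map_res, elem_res, Category.comp_id]

theorem map_toExt_elem {P Q : Presheaf C} (g : P ⟶ Q) {T : E}
    (z : T ⟶ P.X) : (P.elem z).map (Hom.toExt g) = Q.elem (z ≫ g.map) :=
  mk_eq_elem Q _ (⟨z ≫ g.map, by rw [Category.assoc, g.map_σ]⟩ : Q.Section ⟨T, z ≫ P.σ⟩)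

theorem hom_ext_of_elem {P : Presheaf C} {F : (Tot C)ᵒᵖ ⥤ Type (max u v)} {φ ψ : P.ext ⟶ F}
    (h : ∀ {T : E} (z : T ⟶ P.X), (P.elem z).map φ = (P.elem z).map ψ) : φ = ψ := by
  ext X (z : P.Section _)
  obtain ⟨X, a⟩ := X
  obtain ⟨z, hz⟩ := z
  dsimp at z hz
  subst hz
  exact Elem.mk_inj.1 (h z)

theorem exists_hom_of_ext {P Q : Presheaf C} (φ : P.ext ⟶ Q.ext) :
    ∃ g : P ⟶ Q, Hom.toExt g = φ := by
  obtain ⟨e, he⟩ := Q.exists_elem ((P.elem (𝟙 P.X)).map φ)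
  have key : ∀ {T : E} (z : T ⟶ P.X), (P.elem z).map φ = Q.elem (z ≫ e) := fun z => by
    rw [← elem_res, ← he]
    exact map_elem φ z
  have hσ : e ≫ Q.σ = P.σ := by
    have := congrArg Elem.ob he
    rw [Elem.map_ob, elem_ob, elem_ob, Category.id_comp] at this
    exact this.symm
  refine ⟨⟨e, hσ, fun {T} x f h => ?_⟩, hom_ext_of_elem fun z => ?_⟩
  · apply Q.elem_injective
    have h1 : f ≫ C.cod = 𝟙 _ ≫ (P.elem x).ob := by simp [h]
    have h2 : P.elem (P.res x f h) = (P.elem x).pull (𝟙 _) f h1 := by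
      rw [elem_pull]
      exact congrArg _ (P.res_congr (Category.id_comp _).symm rfl _)
    have h3 : f ≫ C.cod = 𝟙 _ ≫ ((P.elem x).map φ).ob := h1
    rw [← key, h2, ← Elem.map_pull _ _ _ _ h3, Elem.pull_congr (key x) rfl rfl, elem_pull]
    exact congrArg _ (Q.res_congr (Category.id_comp _) rfl _)
  · rw [key]
    exact map_toExt_elem (P := P) (Q := Q) _ z

instance : (extFunctor C).Faithful where
  map_injective {P Q} f g h := by
    refine Presheaf.Hom.ext ?_
    have h1 := map_toExt_elem f (𝟙 P.X)
    have h2 := map_toExt_elem g (𝟙 P.X)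
    have h3 : Hom.toExt f = Hom.toExt g := h
    rw [h3, h2] at h1
    simpa using (elem_injective _ h1).symm

instance : (extFunctor C).Full where
  map_surjective φ := exists_hom_of_ext φ

end Presheaf

end Total

/-! ### Recognising internal presheaves, and finite limits of internal presheaves -/

section Representation

open Opposite

variable {E : Type u} [Category.{v} E] [HasFiniteLimits E] {C : InternalCategory E}

/-- A family `s` over `Y` is universal if every family of elements of `F` is a reindexing of `s`
in a unique way: `F`, without the action of the arrows of `C`, is represented by `Y`. -/
def Elem.IsUniversal {F : (Tot C)ᵒᵖ ⥤ Type (max u v)} {Y : E} (s : Elem F Y) : Prop :=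
  ∀ ⦃T : E⦄ (s' : Elem F T), ∃! z : T ⟶ Y, s.res z = s'

/-- The Yoneda lemma for internal presheaves: a family of elements of `F`, indexed by the presheaf
`P` and compatible with the action, gives a morphism from `P` to `F`. -/
def Presheaf.homOfElem (P : Presheaf C) {F : (Tot C)ᵒᵖ ⥤ Type (max u v)} (s : Elem F P.X)
    (hσ : P.σ = s.ob) (hres : ∀ {T : E} (x : T ⟶ P.X) (f : T ⟶ C.mor) (h : x ≫ P.σ = f ≫ C.cod),
      s.res (P.res x f h) = s.pull x f (by rw [← hσ, h])) : P.ext ⟶ F where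
  app X := TypeCat.ofHom fun (z : P.Section X.unop) =>
    F.map (Tot.mk' (a := s.ob) (b := X.unop.ob) z.elt (X.unop.ob ≫ C.one) (by simp [C.one_dom])
      (by rw [← hσ, z.elt_σ]; simp [C.one_cod])).op s.val
  naturality X Y k := by
    ext (z : P.Section _)
    apply Elem.mk_inj.1
    refine (Elem.along_eq_pull s _).trans (Eq.trans ?_
      ((Elem.along_along s _ k.unop).trans (Elem.along_eq_pull s _)).symm)
    have h1 : (k.unop.base ≫ z.elt) ≫ P.σ = k.unop.arr ≫ C.cod := by
      rw [Category.assoc, z.elt_σ, k.unop.arr_cod]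
    have h2 := hres _ _ h1
    refine Eq.trans ?_ (h2.trans (Elem.pull_congr rfl rfl ?_ _))
    · refine (Elem.along_eq_pull s _).symm.trans (Elem.along_congr _ _ _ rfl ?_)
      show Y.unop.ob ≫ C.one = P.res (k.unop.base ≫ z.elt) k.unop.arr h1 ≫ s.ob ≫ C.one
      rw [← hσ, ← Category.assoc _ P.σ, P.res_σ, k.unop.arr_dom]
    · refine (C.one_compose' _ _ ?_ _).symm
      show k.unop.base ≫ X.unop.ob ≫ C.one = _
      rw [reassoc_of% k.unop.arr_cod]

theorem Presheaf.homOfElem_app (P : Presheaf C) {F : (Tot C)ᵒᵖ ⥤ Type (max u v)} (s : Elem F P.X)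
    (hσ : P.σ = s.ob) (hres) {T : E} {a : T ⟶ C.ob} (z : P.Section ⟨T, a⟩) :
    (⟨a, (P.homOfElem s hσ hres).app (op ⟨T, a⟩) z⟩ : Elem F T) = s.res z.elt := by
  refine Elem.along_congr s _ _ rfl ?_
  show a ≫ C.one = z.elt ≫ s.ob ≫ C.one
  rw [← hσ, ← Category.assoc, z.elt_σ]

/-- A presheaf on the total category with a universal family comes from an internal presheaf. -/
theorem Elem.IsUniversal.exists_presheaf {F : (Tot C)ᵒᵖ ⥤ Type (max u v)} {Y : E} {s : Elem F Y}
    (hs : s.IsUniversal) : ∃ P : Presheaf C, Nonempty (P.ext ≅ F) := by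
  obtain ⟨α, hα, -⟩ := hs (s.pull (pullback.fst s.ob C.cod) (pullback.snd s.ob C.cod)
    pullback.condition.symm)
  have inj : ∀ {T : E} {z z' : T ⟶ Y}, s.res z = s.res z' → z = z' := fun {T z z'} h =>
    (hs _).unique h rfl
  let D : PresheafData C := ⟨Y, s.ob, α⟩
  have key : ∀ {T : E} (x : T ⟶ Y) (f : T ⟶ C.mor) (h : x ≫ s.ob = f ≫ C.cod),
      s.res (D.res x f h) = s.pull x f h.symm := fun x f h => by
    show s.res (pullback.lift x f h ≫ α) = _
    rw [← Elem.res_res, hα, Elem.pull_res]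
    exact Elem.pull_congr rfl (by simp) (by simp) _
  have keyσ : ∀ {T : E} (x : T ⟶ Y) (f : T ⟶ C.mor) (h : x ≫ s.ob = f ≫ C.cod),
      D.res x f h ≫ s.ob = f ≫ C.dom := fun x f h => congrArg Elem.ob (key x f h)
  let P : Presheaf C :=
    { D with
      res_σ := keyσ
      res_one := fun x => by
        apply inj
        rw [key]
        exact Elem.pull_eq_res _ _ _ rfl _
      res_compose := fun {T} x f g h h' => by
        apply inj
        have h1 : D.res x f h ≫ s.ob = g ≫ C.cod := by rw [keyσ, h']
        refine (key _ _ _).trans (Eq.trans ?_ (key _ _ h1).symm)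
        have h2 : g ≫ C.cod = 𝟙 T ≫ (s.res (D.res x f h)).ob := by simp [h1]
        have h3 := Elem.res_pull s (D.res x f h) (𝟙 T) g h2
        have h4 := Elem.pull_congr (key x f h) (rfl : 𝟙 T = 𝟙 T) (rfl : g = g) h2
        have h5 := Elem.pull_pull s x f h.symm (𝟙 T) g (by simp [h'])
        refine Eq.trans (Elem.pull_congr rfl (Category.id_comp _).symm
          (C.compose_congr (Category.id_comp _).symm rfl _) _)
          (((h4.trans h5).symm.trans h3).trans (Elem.pull_congr rfl (Category.id_comp _) rfl _)) }
  let φ := P.homOfElem s rfl fun x f h => key x f h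
  have hφ : IsIso φ := by
    rw [NatTrans.isIso_iff_isIso_app]
    intro X
    rw [isIso_iff_bijective]
    obtain ⟨⟨T, a⟩⟩ := X
    constructor
    · intro (z : P.Section _) (z' : P.Section _) h
      refine Presheaf.Section.ext (inj (T := T) ?_)
      have h1 := P.homOfElem_app s rfl (fun x f h => key x f h) z
      have h2 := P.homOfElem_app s rfl (fun x f h => key x f h) z'
      exact (h1.symm.trans (Elem.mk_inj.2 h)).trans h2
    · intro y
      obtain ⟨z, hz, -⟩ := hs ⟨a, y⟩
      have ha : z ≫ s.ob = a := congrArg Elem.ob hz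
      refine ⟨(⟨z, ha⟩ : P.Section _), Elem.mk_inj.1 ?_⟩
      exact (P.homOfElem_app s rfl (fun x f h => key x f h) ⟨z, ha⟩).trans hz
  exact ⟨P, ⟨asIso φ⟩⟩

namespace Presheaf

/-- The terminal presheaf comes from an internal presheaf, with underlying object `C.ob`. -/
theorem exists_terminal :
    ∃ P : Presheaf C, Nonempty (IsTerminal ((extFunctor C).obj P)) := by
  let F : (Tot C)ᵒᵖ ⥤ Type (max u v) := ⊤_ _
  have hF : ∀ X, Nonempty (Unique (F.obj X)) := fun X =>
    ⟨Types.isTerminalEquivUnique _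
      (IsTerminal.isTerminalObj ((evaluation _ _).obj X) F terminalIsTerminal)⟩
  have hsub : ∀ X, Subsingleton (F.obj X) := fun X => (hF X).elim fun h => inferInstance
  have huni : Elem.IsUniversal (⟨𝟙 C.ob, (hF _).some.default⟩ : Elem F C.ob) := by
    rintro T ⟨a, y⟩
    refine ⟨a, ?_, fun z hz => ?_⟩
    · have h : ∀ (s s' : Elem F T), s.ob = s'.ob → s = s' := by
        rintro ⟨b, x⟩ ⟨_, y⟩ rfl
        exact Elem.mk_inj.2 (Subsingleton.elim _ _)
      exact h _ _ (Category.comp_id a)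
    · exact (Category.comp_id z).symm.trans (congrArg Elem.ob hz)
  obtain ⟨P, ⟨e⟩⟩ := huni.exists_presheaf
  exact ⟨P, ⟨terminalIsTerminal.ofIso e.symm⟩⟩

/-- The presheaf of pairs of elements with the same image comes from an internal presheaf on the
pullback of the underlying objects. -/
theorem exists_pullback {P Q R : Presheaf C} (f : P ⟶ R) (g : Q ⟶ R) :
    ∃ (L : Presheaf C) (p : L ⟶ P) (q : L ⟶ Q),
      IsPullback ((extFunctor C).map p) ((extFunctor C).map q) ((extFunctor C).map f)
        ((extFunctor C).map g) := by
  let F := pullback ((extFunctor C).map f) ((extFunctor C).map g)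
  let p : F ⟶ P.ext := pullback.fst ((extFunctor C).map f) ((extFunctor C).map g)
  let q : F ⟶ Q.ext := pullback.snd ((extFunctor C).map f) ((extFunctor C).map g)
  have hpq : IsPullback p q (Hom.toExt f) (Hom.toExt g) :=
    IsPullback.of_hasPullback ((extFunctor C).map f) ((extFunctor C).map g)
  have hX := fun X => hpq.map ((evaluation _ _).obj X)
  -- A family of elements of `F` is a pair of elements of `P` and `Q` with the same image in `R`.
  have hext : ∀ {T : E} (s s' : Elem F T), s.map p = s'.map p → s.map q = s'.map q → s = s' := by
    rintro T ⟨a, x⟩ s' h1 h2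
    obtain rfl : a = s'.ob := congrArg Elem.ob h1
    exact Elem.mk_inj.2 (Types.ext_of_isPullback (hX _) (Elem.mk_inj.1 h1) (Elem.mk_inj.1 h2))
  have hex : ∀ {T : E} (x : T ⟶ P.X) (y : T ⟶ Q.X), x ≫ f.map = y ≫ g.map →
      ∃ s : Elem F T, s.map p = P.elem x ∧ s.map q = Q.elem y := by
    intro T x y h
    have hσ : x ≫ P.σ = y ≫ Q.σ := by rw [← f.map_σ, ← g.map_σ, reassoc_of% h]
    let zx : P.Section ⟨T, x ≫ P.σ⟩ := ⟨x, rfl⟩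
    let zy : Q.Section ⟨T, x ≫ P.σ⟩ := ⟨y, hσ.symm⟩
    obtain ⟨z, hz1, hz2⟩ := Types.exists_of_isPullback (hX (op ⟨T, x ≫ P.σ⟩))
      zx zy (Section.ext (P := R) h)
    refine ⟨⟨_, z⟩, Elem.mk_inj.2 hz1, (Elem.mk_inj.2 hz2).trans (Q.mk_eq_elem _ _)⟩
  obtain ⟨s, hs1, hs2⟩ := hex (pullback.fst f.map g.map) (pullback.snd f.map g.map)
    pullback.condition
  have hs1' : ∀ {T : E} (z : T ⟶ pullback f.map g.map),
      (s.res z).map p = P.elem (z ≫ pullback.fst _ _) :=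
    fun z => by rw [← Elem.map_res, hs1, elem_res]
  have hs2' : ∀ {T : E} (z : T ⟶ pullback f.map g.map),
      (s.res z).map q = Q.elem (z ≫ pullback.snd _ _) :=
    fun z => by rw [← Elem.map_res, hs2, elem_res]
  have huni : s.IsUniversal := by
    intro T s'
    obtain ⟨x, hx⟩ := P.exists_elem (s'.map p)
    obtain ⟨y, hy⟩ := Q.exists_elem (s'.map q)
    have hxy : x ≫ f.map = y ≫ g.map := by
      apply R.elem_injective
      rw [← map_toExt_elem, ← map_toExt_elem, ← hx, ← hy, Elem.map_map, Elem.map_map, hpq.w]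
    refine ⟨pullback.lift x y hxy, hext _ _ ?_ ?_, fun z hz => ?_⟩
    · rw [hs1', pullback.lift_fst, hx]
    · rw [hs2', pullback.lift_snd, hy]
    · subst hz
      ext
      · rw [pullback.lift_fst]
        exact P.elem_injective ((hs1' z).symm.trans hx)
      · rw [pullback.lift_snd]
        exact Q.elem_injective ((hs2' z).symm.trans hy)
  obtain ⟨L, ⟨e⟩⟩ := huni.exists_presheaf
  obtain ⟨p', hp'⟩ := (extFunctor C).map_surjective (X := L) (Y := P) (e.hom ≫ p)
  obtain ⟨q', hq'⟩ := (extFunctor C).map_surjective (X := L) (Y := Q) (e.hom ≫ q)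
  refine ⟨L, p', q', ?_⟩
  rw [hp', hq']
  refine IsPullback.of_iso hpq e.symm (Iso.refl _) (Iso.refl _) (Iso.refl _) ?_ ?_
    ((Category.comp_id _).trans (Category.id_comp _).symm)
    ((Category.comp_id _).trans (Category.id_comp _).symm)
  · exact (Category.comp_id _).trans (e.inv_hom_id_assoc p).symm
  · exact (Category.comp_id _).trans (e.inv_hom_id_assoc q).symm

theorem hasFiniteLimits_and_preserves :
    HasFiniteLimits (Presheaf C) ∧ PreservesFiniteLimits (extFunctor C) := by
  obtain ⟨P, ⟨hP⟩⟩ := exists_terminal (C := C)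
  have hP' : IsTerminal P := IsTerminal.isTerminalOfObj (extFunctor C) P hP
  have : HasTerminal (Presheaf C) := hP'.hasTerminal
  have h1 : PreservesLimitsOfShape (Discrete PEmpty.{1}) (extFunctor C) := by
    have : PreservesLimit (Functor.empty.{0} (Presheaf C)) (extFunctor C) :=
      preservesTerminal_of_iso (extFunctor C)
        (((extFunctor C).mapIso (terminalIsTerminal.uniqueUpToIso hP')).trans
          (hP.uniqueUpToIso terminalIsTerminal))
    exact preservesLimitsOfShape_pempty_of_preservesTerminal _
  have h2 : ∀ {P Q R : Presheaf C} (f : P ⟶ R) (g : Q ⟶ R),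
      HasLimit (cospan f g) ∧ PreservesLimit (cospan f g) (extFunctor C) := by
    intro P Q R f g
    obtain ⟨L, p, q, h⟩ := exists_pullback f g
    have hw : p ≫ f = q ≫ g := (extFunctor C).map_injective (by simpa using h.w)
    have hL : IsPullback p q f g := IsPullback.of_map (extFunctor C) hw h
    exact ⟨hL.hasPullback, preservesLimit_of_preserves_limit_cone hL.isLimit
      ((isLimitMapConePullbackConeEquiv _ hw).symm h.isLimit)⟩
  have : HasPullbacks (Presheaf C) := by
    have : ∀ {P Q R : Presheaf C} {f : P ⟶ R} {g : Q ⟶ R}, HasLimit (cospan f g) :=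
      fun {_ _ _ f g} => (h2 f g).1
    exact hasPullbacks_of_hasLimit_cospan _
  have h3 : PreservesLimitsOfShape WalkingCospan (extFunctor C) :=
    ⟨fun {K} => by
      have := (h2 (K.map WalkingCospan.Hom.inl) (K.map WalkingCospan.Hom.inr)).2
      exact preservesLimit_of_iso_diagram _ (diagramIsoCospan K).symm⟩
  exact ⟨hasFiniteLimits_of_hasTerminal_and_pullbacks,
    preservesFiniteLimits_of_preservesTerminal_and_pullbacks _⟩

end Presheaf

end Representation

/-! ### Families of sieves and the topology on the total category -/

section Site

open Opposite

variable {E : Type u} [Category.{v} E] [PositiveHeytingCategory E] {S : MorphismProperty E}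
  {C : InternalCategory E}

theorem IsSieve.small_arrow (hS : IsClassOfSmallMaps S) {T : E} {a : T ⟶ C.ob}
    {R : Subobject (C.mor ⨯ T)} (hR : IsSieve S a R) : S R.arrow :=
  hS.of_comp _ _ hR.small

/-- A bounded predicate on arrows that is closed under precomposition is a family of small sieves,
because codomain is a small map. -/
theorem exists_isSieve (hS : IsClassOfSmallMaps S) (hC : S C.cod) {T : E} (a : T ⟶ C.ob)
    (φ : ∀ ⦃U : E⦄, (U ⟶ C.mor) → (U ⟶ T) → Prop)
    (hφ : IsBounded S fun U (w : U ⟶ pullback C.cod a) =>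
      φ (w ≫ pullback.fst _ _) (w ≫ pullback.snd _ _))
    (closed : ∀ ⦃U : E⦄ (f g : U ⟶ C.mor) (t : U ⟶ T) (h : f ≫ C.dom = g ≫ C.cod),
      f ≫ C.cod = t ≫ a → φ f t → φ (C.compose f g h) t) :
    ∃ R : Subobject (C.mor ⨯ T), IsSieve S a R ∧
      ∀ ⦃U : E⦄ (f : U ⟶ C.mor) (t : U ⟶ T), Mem R f t ↔ f ≫ C.cod = t ≫ a ∧ φ f t := by
  obtain ⟨A, hA, h⟩ := hφ
  let j : pullback C.cod a ⟶ C.mor ⨯ T := prod.lift (pullback.fst _ _) (pullback.snd _ _)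
  have hj : Mono j := ⟨fun x y hxy => by
    have h1 := hxy =≫ prod.fst
    have h2 := hxy =≫ prod.snd
    simp only [j, Category.assoc, prod.lift_fst, prod.lift_snd] at h1 h2
    exact pullback.hom_ext h1 h2⟩
  have key : ∀ ⦃U : E⦄ (f : U ⟶ C.mor) (t : U ⟶ T), Mem (Subobject.mk (A.arrow ≫ j)) f t ↔
      f ≫ C.cod = t ≫ a ∧ φ f t := by
    intro U f t
    rw [Mem, mk_factors_iff_exists]
    constructor
    · rintro ⟨k, hk⟩
      have h1 := hk =≫ prod.fst
      have h2 := hk =≫ prod.snd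
      simp only [j, Category.assoc, prod.lift_fst, prod.lift_snd] at h1 h2
      rw [← h1, ← h2]
      have := (h _).1 (Subobject.factors_comp_arrow (P := A) k)
      simp only [Category.assoc] at this
      exact ⟨by simp [pullback.condition], this⟩
    · rintro ⟨h1, h2⟩
      have h3 : A.Factors (pullback.lift f t h1) := (h _).2 (by simpa using h2)
      exact ⟨A.factorThru _ h3, by ext <;> simp [j]⟩
  refine ⟨Subobject.mk (A.arrow ≫ j),
    ⟨?_, fun f t hf => ((key f t).1 hf).1, fun f g t hfg hf => ?_⟩, key⟩
  · rw [← Subobject.underlyingIso_hom_comp_eq_mk, Category.assoc, Category.assoc, prod.lift_snd]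
    exact hS.composition _ _ (hS.iso _) (hS.composition _ _ hA (hS.pullback_snd _ _ hC))
  · obtain ⟨h1, h2⟩ := (key f t).1 hf
    exact (key _ _).2 ⟨by rw [C.compose_cod, h1], closed f g t hfg h1 h2⟩

theorem isBounded_mem (hS : IsClassOfSmallMaps S) {T Y : E} {a : T ⟶ C.ob}
    {R : Subobject (C.mor ⨯ T)} (hR : IsSieve S a R) (f : Y ⟶ C.mor) (t : Y ⟶ T) :
    IsBounded S fun U (y : U ⟶ Y) => Mem R (y ≫ f) (y ≫ t) := by
  refine (IsBounded.precomp hS (φ := fun U x => R.Factors x)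
    ⟨R, hR.small_arrow hS, fun _ _ => Iff.rfl⟩ (prod.lift f t)).congr fun U y => ?_
  rw [Mem, prod.comp_lift]

/-- The pullback of a family of sieves along a family of arrows. -/
theorem IsSieve.exists_pullback (hS : IsClassOfSmallMaps S) (hC : S C.cod) {T U : E} {a : T ⟶ C.ob}
    {R : Subobject (C.mor ⨯ T)} (hR : IsSieve S a R) (t : U ⟶ T) (f : U ⟶ C.mor) :
    ∃ R' : Subobject (C.mor ⨯ U), IsSieve S (f ≫ C.dom) R' ∧
      ∀ ⦃V : E⦄ (w : V ⟶ U) (g : V ⟶ C.mor) (h : (w ≫ f) ≫ C.dom = g ≫ C.cod),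
        Mem R' g w ↔ Mem R (C.compose (w ≫ f) g h) (w ≫ t) := by
  have e := pullback.condition (f := C.cod) (g := f ≫ C.dom)
  obtain ⟨R', h1, h2⟩ := exists_isSieve hS hC (f ≫ C.dom)
    (fun V g w => ∃ h : (w ≫ f) ≫ C.dom = g ≫ C.cod, Mem R (C.compose (w ≫ f) g h) (w ≫ t))
    ((isBounded_mem hS hR (C.compose (pullback.snd C.cod (f ≫ C.dom) ≫ f) (pullback.fst _ _)
      (by rw [Category.assoc, e])) (pullback.snd _ _ ≫ t)).congr fun V w => by
        rw [C.comp_compose, ← Category.assoc w _ t,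
          C.compose_congr (Category.assoc w _ f).symm rfl]
        exact ⟨fun h => ⟨_, h⟩, fun ⟨_, h⟩ => h⟩)
    (fun V g k w hgk hg ⟨h, hm⟩ => ⟨by rw [C.compose_cod, h], by
      rw [← C.assoc _ _ _ h hgk]
      exact hR.closed _ _ _ _ hm⟩)
  refine ⟨R', h1, fun V w g h => (h2 g w).trans ⟨fun ⟨_, _, h⟩ => h, fun h' => ⟨?_, h, h'⟩⟩⟩
  rw [← h, Category.assoc]

namespace ObjectOfSieves

variable (O : ObjectOfSieves S C)

/-- `M`, with the generic arrow `f` and the generic index `m`, is the object of members of the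
family `c` of sieves. -/
structure IsMembers {T M : E} (c : T ⟶ O.K) (f : M ⟶ C.mor) (m : M ⟶ T) : Prop where
  mem : Mem O.sieve f (m ≫ c)
  existsUnique : ∀ ⦃U : E⦄ (g : U ⟶ C.mor) (t : U ⟶ T), Mem O.sieve g (t ≫ c) →
    ∃! k : U ⟶ M, k ≫ f = g ∧ k ≫ m = t

theorem isMembers_pullback {T : E} (c : T ⟶ O.K) :
    O.IsMembers c (pullback.fst (O.sieve.arrow ≫ prod.snd) c ≫ O.sieve.arrow ≫ prod.fst)
      (pullback.snd (O.sieve.arrow ≫ prod.snd) c) := by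
  have e := pullback.condition (f := O.sieve.arrow ≫ prod.snd) (g := c)
  refine ⟨?_, fun U g t h => ?_⟩
  · rw [← e, Mem, ← prod.comp_lift]
    have e' : prod.lift (O.sieve.arrow ≫ prod.fst) (O.sieve.arrow ≫ prod.snd) = O.sieve.arrow := by
      ext <;> simp
    rw [e']
    exact Subobject.factors_comp_arrow _
  · refine ⟨pullback.lift (O.sieve.factorThru _ h) t (by simp), ⟨by simp, by simp⟩, ?_⟩
    rintro k ⟨h1, h2⟩
    apply pullback.hom_ext
    · rw [← cancel_mono O.sieve.arrow, pullback.lift_fst, Subobject.factorThru_arrow]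
      ext
      · simpa using h1
      · simp only [Category.assoc, prod.lift_snd]
        rw [e, reassoc_of% h2]
    · rw [pullback.lift_snd, h2]

theorem exists_members (hS : IsClassOfSmallMaps S) {T : E} (c : T ⟶ O.K) :
    ∃ (M : E) (f : M ⟶ C.mor) (m : M ⟶ T), S m ∧ O.IsMembers c f m :=
  ⟨_, _, _, hS.pullback_snd _ _ O.isSieve.small, O.isMembers_pullback c⟩

theorem mem_comp {T U V : E} {c : T ⟶ O.K} {f : U ⟶ C.mor} {t : U ⟶ T} (r : V ⟶ U)
    (h : Mem O.sieve f (t ≫ c)) : Mem O.sieve (r ≫ f) ((r ≫ t) ≫ c) := by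
  have := factors_comp r h
  rwa [prod.comp_lift, ← Category.assoc] at this

/-- A family of sieves taken from an object of sieves is a family of sieves. -/
theorem exists_isSieve_of_hom (hS : IsClassOfSmallMaps S) (hC : S C.cod) {T : E} (c : T ⟶ O.K) :
    ∃ R : Subobject (C.mor ⨯ T), IsSieve S (c ≫ O.base) R ∧
      ∀ ⦃U : E⦄ (t : U ⟶ T) (f : U ⟶ C.mor), Mem O.sieve f (t ≫ c) ↔ Mem R f t := by
  obtain ⟨R, h1, h2⟩ := exists_isSieve hS hC (c ≫ O.base) (fun U f t => Mem O.sieve f (t ≫ c))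
    ((isBounded_mem hS O.isSieve (pullback.fst _ _) (pullback.snd _ _ ≫ c)).congr fun U w => by
      rw [Category.assoc])
    (fun U f g t h _ hf => O.isSieve.closed f g _ h hf)
  refine ⟨R, h1, fun U t f => ⟨fun h => (h2 f t).2 ⟨?_, h⟩, fun h => ((h2 f t).1 h).2⟩⟩
  rw [O.isSieve.cod_eq _ _ h, Category.assoc]

end ObjectOfSieves

namespace Topology.IsPresentation

variable {J : Topology S C} {B : ObjectOfSieves S C} (hB : J.IsPresentation B)

include hB

/-- A family of covering sieves has, locally, a basic refinement. -/
theorem exists_refinement (hS : IsClassOfSmallMaps S) (hC : S C.cod) {T : E} (c : T ⟶ J.K) :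
    ∃ (T' : E) (p : T' ⟶ T) (b : T' ⟶ B.K), IsRegularEpi p ∧ b ≫ B.base = p ≫ c ≫ J.base ∧
      ∀ ⦃U : E⦄ (t : U ⟶ T') (f : U ⟶ C.mor), Mem B.sieve f (t ≫ b) →
        Mem J.sieve f (t ≫ p ≫ c) := by
  obtain ⟨R, h1, h2⟩ := J.exists_isSieve_of_hom hS hC c
  obtain ⟨T', p, b, hp, hb, h⟩ := (hB.covers_iff _ R h1).1 ⟨c, rfl, fun t f => h2 t f⟩
  refine ⟨T', p, b, hp, hb, fun U t f hf => ?_⟩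
  rw [← Category.assoc]
  exact (h2 _ _).2 (h t f hf)

theorem exists_basic (hS : IsClassOfSmallMaps S) (hC : S C.cod) {T : E} (a : T ⟶ C.ob) :
    ∃ (T' : E) (p : T' ⟶ T) (b : T' ⟶ B.K), IsRegularEpi p ∧ b ≫ B.base = p ≫ a := by
  obtain ⟨c, hc, -⟩ := J.maximality a
  obtain ⟨T', p, b, hp, hb, -⟩ := hB.exists_refinement hS hC c
  exact ⟨T', p, b, hp, by rw [hb, hc]⟩

/-- A family of basic sieves is a family of covering sieves. -/
theorem exists_cov (hS : IsClassOfSmallMaps S) (hC : S C.cod) {T : E} (b : T ⟶ B.K) :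
    ∃ c : T ⟶ J.K, c ≫ J.base = b ≫ B.base ∧
      ∀ ⦃U : E⦄ (t : U ⟶ T) (f : U ⟶ C.mor), Mem J.sieve f (t ≫ c) ↔ Mem B.sieve f (t ≫ b) := by
  obtain ⟨R, h1, h2⟩ := B.exists_isSieve_of_hom hS hC b
  obtain ⟨c, hc, h⟩ := (hB.covers_iff _ R h1).2 ⟨T, 𝟙 T, b, inferInstance, by simp,
    fun t f hf => by simpa using (h2 t f).1 hf⟩
  exact ⟨c, hc, fun U t f => (h t f).trans (h2 t f).symm⟩

theorem exists_stable (hS : IsClassOfSmallMaps S) (hC : S C.cod) {T : E} (b : T ⟶ B.K)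
    (f : T ⟶ C.mor) (hf : f ≫ C.cod = b ≫ B.base) :
    ∃ (T' : E) (p : T' ⟶ T) (b' : T' ⟶ B.K), IsRegularEpi p ∧ b' ≫ B.base = p ≫ f ≫ C.dom ∧
      ∀ ⦃U : E⦄ (t : U ⟶ T') (g : U ⟶ C.mor) (h : ((t ≫ p) ≫ f) ≫ C.dom = g ≫ C.cod),
        Mem B.sieve g (t ≫ b') → Mem B.sieve (C.compose ((t ≫ p) ≫ f) g h) ((t ≫ p) ≫ b) := by
  obtain ⟨c, hc, hcb⟩ := hB.exists_cov hS hC b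
  obtain ⟨d, hd, hdf⟩ := J.stability c f (by rw [hf, hc])
  obtain ⟨T', p, b', hp, hb', h⟩ := hB.exists_refinement hS hC d
  refine ⟨T', p, b', hp, by rw [hb', hd], fun U t g hg hm => ?_⟩
  have h1 := h t g hm
  rw [← Category.assoc] at h1
  exact (hcb _ _).1 ((hdf _ _ hg).1 h1)

end Topology.IsPresentation

/-- Membership of a sieve of the total category, in terms of generalised elements. -/
def MemSieve {X : Tot C} (ρ : Sieve X) {U : E} (t : U ⟶ X.base) (f : U ⟶ C.mor) : Prop :=
  ∃ h : f ≫ C.cod = t ≫ X.ob, ρ.arrows (Tot.mk' (a := X.ob) t f rfl h)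

namespace MemSieve

variable {X Y : Tot C} {ρ : Sieve X}

theorem iff_arrows (k : Y ⟶ X) : ρ.arrows k ↔ MemSieve ρ k.base k.arr := by
  obtain ⟨Y, b⟩ := Y
  obtain ⟨k, f, hd, hc⟩ := k
  dsimp at k f hd
  subst hd
  exact ⟨fun h => ⟨hc, h⟩, fun ⟨_, h⟩ => h⟩

theorem congr {U : E} {t t' : U ⟶ X.base} {f f' : U ⟶ C.mor} (h : MemSieve ρ t f) (ht : t = t')
    (hf : f = f') : MemSieve ρ t' f' := by
  subst ht hf
  exact h

theorem compose {U V : E} {t : U ⟶ X.base} {f : U ⟶ C.mor} (h : MemSieve ρ t f) (w : V ⟶ U)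
    (g : V ⟶ C.mor) (hg : (w ≫ f) ≫ C.dom = g ≫ C.cod) :
    MemSieve ρ (w ≫ t) (C.compose (w ≫ f) g hg) := by
  obtain ⟨h, hρ⟩ := h
  exact (iff_arrows _).1 (ρ.downward_closed hρ
    (Tot.mk' (a := f ≫ C.dom) w g rfl (by rw [← hg, Category.assoc])))

theorem pullback_iff (k : Y ⟶ X) {U : E} (t : U ⟶ Y.base) (f : U ⟶ C.mor)
    (h : (t ≫ k.arr) ≫ C.dom = f ≫ C.cod) :
    MemSieve (ρ.pullback k) t f ↔ MemSieve ρ (t ≫ k.base) (C.compose (t ≫ k.arr) f h) := by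
  have h' : f ≫ C.cod = t ≫ Y.ob := by rw [← h, Category.assoc, k.arr_dom]
  constructor
  · rintro ⟨_, hm⟩
    exact (iff_arrows (ρ := ρ) (Tot.mk' (a := Y.ob) t f rfl h' ≫ k)).1 hm
  · intro hm
    exact ⟨h', (iff_arrows (ρ := ρ) (Tot.mk' (a := Y.ob) t f rfl h' ≫ k)).2 hm⟩

end MemSieve

variable (B : ObjectOfSieves S C)

/-- A sieve on a family of objects is covering if, after reindexing along a cover, there is a
family of basic sieves all of whose members are locally (on covers) in the sieve. -/
def IsCovering {X : Tot C} (ρ : Sieve X) : Prop :=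
  ∃ (T : E) (p : T ⟶ X.base) (b : T ⟶ B.K), IsRegularEpi p ∧ b ≫ B.base = p ≫ X.ob ∧
    ∀ ⦃U : E⦄ (t : U ⟶ T) (f : U ⟶ C.mor), Mem B.sieve f (t ≫ b) →
      ∃ (V : E) (r : V ⟶ U), IsRegularEpi r ∧ MemSieve ρ (r ≫ t ≫ p) (r ≫ f)

variable {B} {J : Topology S C} (hS : IsClassOfSmallMaps S) (hC : S C.cod)
  (hB : J.IsPresentation B)

include hS hC hB

theorem isCovering_top (X : Tot C) : IsCovering B (⊤ : Sieve X) := by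
  obtain ⟨T, p, b, hp, hb⟩ := hB.exists_basic hS hC X.ob
  refine ⟨T, p, b, hp, hb, fun U t f hf => ⟨U, 𝟙 U, inferInstance, ?_, trivial⟩⟩
  have := B.isSieve.cod_eq _ _ hf
  simp [this, hb]

theorem IsCovering.pullback {X Y : Tot C} {ρ : Sieve X} (hρ : IsCovering B ρ) (k : Y ⟶ X) :
    IsCovering B (ρ.pullback k) := by
  obtain ⟨T, p, b, hp, hb, h⟩ := hρ
  obtain ⟨U, q, u, hq, hu⟩ := exists_cover_lift p hp k.base
  obtain ⟨V, q', b', hq', hb', h'⟩ := hB.exists_stable hS hC (u ≫ b) (q ≫ k.arr) (by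
    rw [Category.assoc, Category.assoc, k.arr_cod, hb, reassoc_of% hu])
  refine ⟨V, q' ≫ q, b', isRegularEpi_comp _ _ hq' hq, by simp [hb', k.arr_dom], fun W t f hf => ?_⟩
  have e : ((t ≫ q') ≫ q ≫ k.arr) ≫ C.dom = f ≫ C.cod := by
    rw [B.isSieve.cod_eq _ _ hf]
    simp only [Category.assoc]
    rw [hb']
    simp
  have h1 := h' t f e hf
  rw [← Category.assoc _ u b] at h1
  obtain ⟨W', r, hr, hm⟩ := h _ _ h1
  refine ⟨W', r, hr, (MemSieve.pullback_iff k _ _ ?_).2 (hm.congr ?_ ?_)⟩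
  · simpa using r ≫= e
  · simp [hu]
  · rw [C.comp_compose]
    exact C.compose_congr (by simp) rfl _

/-- Local character. The basic sieves that exist on the members of a basic sieve `b` cannot be
chosen as a function of the member; collection provides a small family of choices that suffices,
and the composites of members of `b` with members of the chosen sieves form a small sieve. -/
theorem IsCovering.transitive {X : Tot C} {ρ ψ : Sieve X} (hρ : IsCovering B ρ)
    (hψ : ∀ ⦃Y : Tot C⦄ (k : Y ⟶ X), ρ.arrows k → IsCovering B (ψ.pullback k)) :
    IsCovering B ψ := by
  obtain ⟨T, p, b, hp, hb, hρ⟩ := hρ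
  obtain ⟨M, f, m, hm, ⟨hf, huniv⟩⟩ := B.exists_members hS b
  obtain ⟨V, r, hr, hc, hρr⟩ := hρ m f hf
  obtain ⟨V', p', b', hp', hb', hψ'⟩ := hψ _ hρr
  dsimp at p' hb'
  obtain ⟨Z, A, z, g, h, ⟨⟨w, he⟩, hh⟩, hg⟩ :=
    hS.collection (p' ≫ r) m (isRegularEpi_comp _ _ hp' hr) hm
  obtain ⟨N, k, n, hn, ⟨hk, hNuniv⟩⟩ := B.exists_members hS (z ≫ b')
  have hkc : k ≫ C.cod = n ≫ z ≫ p' ≫ r ≫ f ≫ C.dom := by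
    rw [B.isSieve.cod_eq _ _ hk]
    simp only [Category.assoc]
    rw [hb']
    simp
  have hFk : (n ≫ z ≫ p' ≫ r ≫ f) ≫ C.dom = k ≫ C.cod := by simp [hkc]
  obtain ⟨I, e, i, hei, hi, hF⟩ := exists_image (prod.lift (C.compose _ k hFk) (n ≫ g))
  -- `R` is the sieve of composites of members of `b` with members of the sieves chosen on them.
  have hR1 : ∀ ⦃U : E⦄ (y : U ⟶ N), Mem (Subobject.mk i) (y ≫ C.compose _ k hFk) (y ≫ n ≫ g) := by
    intro U y
    rw [Mem, mk_factors_iff_exists]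
    exact ⟨y ≫ e, by rw [Category.assoc, hF, prod.comp_lift]⟩
  have hR2 : ∀ ⦃U : E⦄ (l : U ⟶ C.mor) (t : U ⟶ A), Mem (Subobject.mk i) l t →
      ∃ (W : E) (s : W ⟶ U) (y : W ⟶ N), IsRegularEpi s ∧ y ≫ C.compose _ k hFk = s ≫ l ∧
        y ≫ n ≫ g = s ≫ t := by
    intro U l t hlt
    obtain ⟨x, hx⟩ := (mk_factors_iff_exists _ _).1 hlt
    obtain ⟨W, s, y, hs, hy⟩ := exists_cover_lift e hei x
    have h1 : y ≫ prod.lift (C.compose _ k hFk) (n ≫ g) = s ≫ prod.lift l t := by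
      rw [← hF, reassoc_of% hy, hx]
    have h2 := h1 =≫ prod.fst
    have h3 := h1 =≫ prod.snd
    simp only [Category.assoc, prod.lift_fst, prod.lift_snd] at h2 h3
    exact ⟨W, s, y, hs, h2, h3⟩
  obtain ⟨c, hcb, hcm⟩ := hB.exists_cov hS hC (h ≫ b)
  have hR : IsSieve S (c ≫ J.base) (Subobject.mk i) := by
    refine ⟨?_, fun {U} l t hlt => ?_, fun {U} l l' t hl hlt => ?_⟩
    · rw [← Subobject.underlyingIso_hom_comp_eq_mk, Category.assoc]
      refine hS.composition _ _ (hS.iso _) (hS.quotients e _ hei ?_)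
      rw [reassoc_of% hF, prod.lift_snd]
      exact hS.composition _ _ hn hg
    · obtain ⟨W, s, y, hs, h1, h2⟩ := hR2 l t hlt
      apply eq_of_cover hs
      rw [← reassoc_of% h1, ← reassoc_of% h2, C.compose_cod, hcb]
      simp only [Category.assoc]
      rw [B.isSieve.cod_eq _ _ hf, Category.assoc, reassoc_of% w]
    · obtain ⟨W, s, y, hs, h1, h2⟩ := hR2 l t hlt
      refine factors_of_cover hs ?_
      have e1 : (y ≫ k) ≫ C.dom = (s ≫ l') ≫ C.cod := by
        have := s ≫= hl
        rw [← Category.assoc, ← h1, Category.assoc, C.compose_dom] at this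
        simpa using this
      have h3 := B.isSieve.closed (y ≫ k) (s ≫ l') _ e1 (B.mem_comp y hk)
      obtain ⟨y', ⟨hy1, hy2⟩, -⟩ := hNuniv _ _ h3
      have h4 := hR1 y'
      rw [prod.comp_lift, ← h2]
      have e2 : s ≫ C.compose l l' hl = y' ≫ C.compose _ k hFk := by
        rw [C.comp_compose, C.comp_compose, C.compose_congr h1.symm rfl,
          C.compose_congr (C.comp_compose _ _ _ _) rfl, C.assoc _ _ _ _ e1]
        exact C.compose_congr (by rw [reassoc_of% hy2]) hy1.symm _
      rw [e2, ← reassoc_of% hy2]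
      exact h4
  obtain ⟨c', hc', hc'R⟩ := J.localCharacter c (Subobject.mk i) hR (by
    intro U t l hl
    have hl' := (hcm _ _).1 hl
    rw [← Category.assoc] at hl'
    obtain ⟨y, ⟨hy1, hy2⟩, -⟩ := huniv _ _ hl'
    obtain ⟨R', hR', hRR'⟩ := hR.exists_pullback hS hC t l
    obtain ⟨U', q, ζ, hq, hζ⟩ := exists_cover_lift _ he (pullback.lift y t hy2)
    have hζ1 := hζ =≫ pullback.fst _ _
    have hζ2 := hζ =≫ pullback.snd _ _
    simp only [Category.assoc, pullback.lift_fst, pullback.lift_snd] at hζ1 hζ2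
    have hlζ : q ≫ l = ζ ≫ z ≫ p' ≫ r ≫ f := by rw [← hy1, ← reassoc_of% hζ1]
    have := (hB.covers_iff _ R' hR').2 ⟨U', q, ζ ≫ z ≫ b', hq, ?_, fun {W} s l' hl' => ?_⟩
    · obtain ⟨d, hd, hd'⟩ := this
      exact ⟨d, hd, fun w g' hg' => (hd' w g').trans (hRR' w g' hg')⟩
    · rw [← Category.assoc q, hlζ]
      simp only [Category.assoc]
      rw [hb']
      simp
    · rw [← Category.assoc s] at hl'
      obtain ⟨y', ⟨hy'1, hy'2⟩, -⟩ := hNuniv _ _ hl'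
      have e1 : ((s ≫ q) ≫ l) ≫ C.dom = l' ≫ C.cod := by
        rw [← hy'1]
        simp only [Category.assoc]
        rw [hkc, reassoc_of% hy'2, reassoc_of% hlζ]
      refine (hRR' _ _ e1).2 ?_
      have h4 := hR1 y'
      have e2 : y' ≫ C.compose _ k hFk = C.compose ((s ≫ q) ≫ l) l' e1 := by
        rw [C.comp_compose]
        exact C.compose_congr (by rw [reassoc_of% hy'2, Category.assoc s, hlζ]) hy'1 _
      rw [e2, reassoc_of% hy'2, hζ2, ← Category.assoc] at h4
      exact h4)
  obtain ⟨T₃, p₃, b₃, hp₃, hb₃, h₃⟩ := hB.exists_refinement hS hC c'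
  refine ⟨T₃, p₃ ≫ h ≫ p, b₃, isRegularEpi_comp _ _ hp₃ (isRegularEpi_comp _ _ hh hp), ?_,
    fun U t l hl => ?_⟩
  · simp [hb₃, hc', hcb, hb]
  · have h4 := h₃ t l hl
    rw [← Category.assoc] at h4
    obtain ⟨W, s, y, hs, h1, h2⟩ := hR2 _ _ ((hc'R _ _).1 h4)
    have h5 := B.mem_comp y hk
    rw [← Category.assoc] at h5
    obtain ⟨W', r', hr', hψr⟩ := hψ' _ _ h5
    refine ⟨W', r' ≫ s, isRegularEpi_comp _ _ hr' hs, ?_⟩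
    have e1 : ((r' ≫ ((y ≫ n) ≫ z) ≫ p') ≫ r ≫ f) ≫ C.dom = (r' ≫ y ≫ k) ≫ C.cod := by
      simp [hkc]
    refine ((MemSieve.pullback_iff _ _ _ e1).1 hψr).congr ?_ ?_
    · show (r' ≫ ((y ≫ n) ≫ z) ≫ p') ≫ (r ≫ m ≫ p) = _
      have h6 := w =≫ p
      simp only [Category.assoc] at h6 h2 ⊢
      rw [h6, reassoc_of% h2]
    · rw [Category.assoc r' s, ← h1, C.comp_compose, C.comp_compose]
      exact C.compose_congr (by simp [Tot.mk']) rfl _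

/-- The topology on the total category generated by the covers of `E` and the covering sieves of
the internal site. -/
def siteTopology : GrothendieckTopology (Tot C) where
  sieves _ := {ρ | IsCovering B ρ}
  top_mem' := isCovering_top hS hC hB
  pullback_stable' _ _ _ k hρ := IsCovering.pullback hS hC hB hρ k
  transitive' _ _ hρ _ hψ := IsCovering.transitive hS hC hB hρ fun _ _ hk => hψ hk

end Site

/-! ### Internal sheaves as sheaves on the total category -/

section Sheaves

open Opposite

universe w

/-- The sieve of morphisms factoring through a given one. -/
abbrev principalSieve {D : Type*} [Category* D] {X Y : D} (k : Y ⟶ X) : Sieve X :=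
  Sieve.generate (Presieve.singleton k)

theorem principalSieve_arrows {D : Type*} [Category* D] {X Y Z : D} (k : Y ⟶ X) (l : Z ⟶ X) :
    (principalSieve k).arrows l ↔ ∃ j, j ≫ k = l :=
  ⟨fun ⟨_, j, _, ⟨⟩, h⟩ => ⟨j, h⟩, fun ⟨j, h⟩ => ⟨_, j, _, ⟨⟩, h⟩⟩

theorem isSheafFor_principalSieve {D : Type*} [Category* D] {F : Dᵒᵖ ⥤ Type w} {X Y : D}
    (k : Y ⟶ X) : Presieve.IsSheafFor F (principalSieve k).arrows ↔
      ∀ x : F.obj (op Y), (∀ {Z : D} (p₁ p₂ : Z ⟶ Y), p₁ ≫ k = p₂ ≫ k →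
        F.map p₁.op x = F.map p₂.op x) → ∃! y, F.map k.op y = x := by
  rw [← Presieve.isSheafFor_iff_generate, Presieve.isSheafFor_singleton]

section

variable {E : Type u} [Category.{v} E] [PositiveHeytingCategory E] {C : InternalCategory E}

theorem principalSieve_cart_arrows {X Y : Tot C} {T : E} (p : T ⟶ X.base) (k : Y ⟶ X) :
    (principalSieve (Tot.cart X.ob p)).arrows k ↔ ∃ u, u ≫ p = k.base := by
  rw [principalSieve_arrows]
  constructor
  · rintro ⟨j, rfl⟩
    exact ⟨j.base, rfl⟩
  · rintro ⟨u, hu⟩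
    refine ⟨Tot.mk' (a := p ≫ X.ob) u k.arr k.arr_dom (by rw [k.arr_cod, reassoc_of% hu]),
      Tot.Hom.ext hu (C.one_compose' _ _ ?_ _)⟩
    show u ≫ p ≫ X.ob ≫ C.one = k.arr ≫ C.cod ≫ C.one
    rw [reassoc_of% hu, reassoc_of% k.arr_cod]

theorem ObjectOfSieves.IsMembers.principalSieve_arrows {S : MorphismProperty E}
    {O : ObjectOfSieves S C} {X Y : Tot C} {M : E} {c : X.base ⟶ O.K} {f : M ⟶ C.mor}
    {m : M ⟶ X.base} (hM : O.IsMembers c f m) (h : f ≫ C.cod = m ≫ X.ob) (k : Y ⟶ X) :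
    (principalSieve (Tot.mk' (a := X.ob) m f rfl h)).arrows k ↔
      Mem O.sieve k.arr (k.base ≫ c) := by
  rw [AST.principalSieve_arrows]
  constructor
  · rintro ⟨j, rfl⟩
    have h1 := factors_comp j.base hM.mem
    rw [prod.comp_lift, ← Category.assoc] at h1
    exact O.isSieve.closed _ _ _ _ h1
  · intro hk
    obtain ⟨y, ⟨hy1, hy2⟩, -⟩ := hM.existsUnique _ _ hk
    refine ⟨Tot.mk' y (y ≫ f ≫ C.dom ≫ C.one) ?_ (by simp [C.one_cod]),
      Tot.Hom.ext hy2 ((C.compose_one' _ _ ?_ _).trans hy1)⟩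
    · rw [reassoc_of% hy1]
      simp [C.one_dom, k.arr_dom]
    · show y ≫ f ≫ C.dom ≫ C.one = (y ≫ f) ≫ C.dom ≫ C.one
      rw [Category.assoc]

/-- The presheaf of families of elements of an internal presheaf is a sheaf for the covers of
`E`. -/
theorem Presheaf.isSheafFor_ext_cart (P : Presheaf C) {T T' : E} (a : T ⟶ C.ob)
    (p : T' ⟶ T) (hp : IsRegularEpi p) :
    Presieve.IsSheafFor P.ext (principalSieve (Tot.cart a p)).arrows := by
  rw [isSheafFor_principalSieve]
  intro (x : P.Section ⟨T', p ≫ a⟩) hx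
  have hxσ : x.elt ≫ P.σ = p ≫ a := x.elt_σ
  have key : ∀ (z : P.Section ⟨T, a⟩), (P.ext.map (Tot.cart a p).op z) = x ↔ p ≫ z.elt = x.elt := by
    intro z
    have h1 : (show P.Section ⟨T', p ≫ a⟩ from P.ext.map (Tot.cart a p).op z).elt = p ≫ z.elt :=
      P.res_one' _ _ (by rw [Category.assoc, ← Category.assoc z.elt, z.elt_σ]; rfl) _
    rw [← h1]
    exact Section.ext_iff (P := P)
  obtain ⟨z, hz⟩ := exists_desc_of_cover p hp x.elt fun U u w h => by
    let k₁ : (⟨U, u ≫ p ≫ a⟩ : Tot C) ⟶ ⟨T', p ≫ a⟩ := Tot.cart (p ≫ a) u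
    let k₂ : (⟨U, u ≫ p ≫ a⟩ : Tot C) ⟶ ⟨T', p ≫ a⟩ := Tot.mk' w (w ≫ (p ≫ a) ≫ C.one)
      (by simp [C.one_dom, reassoc_of% h]) (by simp [C.one_cod])
    have hk : k₁ ≫ Tot.cart a p = k₂ ≫ Tot.cart a p :=
      Tot.Hom.ext h (C.compose_congr (by simp [k₁, k₂, Tot.cart, Tot.mk', reassoc_of% h])
        (by simp [k₁, k₂, Tot.cart, Tot.mk', reassoc_of% h]) _)
    have h1 := congrArg Section.elt (hx k₁ k₂ hk)
    have h2 : P.res (u ≫ x.elt) (u ≫ (p ≫ a) ≫ C.one) _ = u ≫ x.elt :=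
      P.res_one' _ _ (by simp only [Category.assoc]; rw [reassoc_of% hxσ]) (by
        rw [Category.assoc, x.elt_σ]; simp [C.one_cod])
    have h3 : P.res (w ≫ x.elt) (w ≫ (p ≫ a) ≫ C.one) _ = w ≫ x.elt :=
      P.res_one' _ _ (by simp only [Category.assoc]; rw [reassoc_of% hxσ]) (by
        rw [Category.assoc, x.elt_σ]; simp [C.one_cod])
    exact h2.symm.trans (h1.trans h3)
  have hσ : z ≫ P.σ = a := by
    apply eq_of_cover hp
    rw [reassoc_of% hz, x.elt_σ]
  refine ⟨(⟨z, hσ⟩ : P.Section _), (key _).2 hz, fun y hy => ?_⟩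
  refine Section.ext (P := P) (eq_of_cover hp ?_)
  rw [(key y).1 hy, hz]

/-- The sheaf condition for the sieve generated by the generic member of a family of internal
covering sieves is the internal sheaf condition. -/
theorem Presheaf.isSheafFor_ext_members {S : MorphismProperty E} {J : Topology S C}
    (P : Presheaf C) (hP : J.IsSheaf P) {T : E} (a : T ⟶ C.ob) (c : T ⟶ J.K)
    (h : J.arrow c ≫ C.cod = J.index c ≫ a) (hc : c ≫ J.base = a) :
    Presieve.IsSheafFor P.ext
      (principalSieve (Tot.mk' (a := a) (J.index c) (J.arrow c) rfl h)).arrows := by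
  subst hc
  rw [isSheafFor_principalSieve]
  intro (x : P.Section ⟨_, J.arrow c ≫ C.dom⟩) hx
  obtain ⟨z, ⟨hz, hzx⟩, huniq⟩ := hP c x.elt ⟨x.elt_σ, fun {U} m n g hg hmn hn => by
    let k₁ : (⟨U, g ≫ C.dom⟩ : Tot C) ⟶ ⟨_, J.arrow c ≫ C.dom⟩ :=
      Tot.mk' n (n ≫ J.arrow c ≫ C.dom ≫ C.one)
        (by rw [reassoc_of% hn, ← Category.assoc, C.compose_dom]; simp [C.one_dom])
        (by simp [C.one_cod])
    let k₂ : (⟨U, g ≫ C.dom⟩ : Tot C) ⟶ ⟨_, J.arrow c ≫ C.dom⟩ :=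
      Tot.mk' m g rfl (by rw [← hg, Category.assoc])
    have hk : k₁ ≫ Tot.mk' (a := c ≫ J.base) (J.index c) (J.arrow c) rfl h =
        k₂ ≫ Tot.mk' (J.index c) (J.arrow c) rfl h :=
      Tot.Hom.ext hmn.symm ((C.compose_one' _ _ (by simp [k₁, Tot.mk']) _).trans hn)
    have h1 := congrArg Section.elt (hx k₁ k₂ hk)
    have h2 : P.res (n ≫ x.elt) (n ≫ J.arrow c ≫ C.dom ≫ C.one) _ = n ≫ x.elt :=
      P.res_one' _ _ (by
        rw [Category.assoc, ← Category.assoc x.elt, x.elt_σ, Category.assoc]) (by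
        rw [Category.assoc, x.elt_σ]; simp [C.one_cod])
    exact h2.symm.trans h1⟩
  let z' : P.Section ⟨T, c ≫ J.base⟩ := ⟨z, hz⟩
  refine ⟨z', Section.ext (P := P) hzx, fun y hy => ?_⟩
  exact Section.ext (P := P)
    (huniq _ ⟨Section.elt_σ (P := P) y, congrArg (Section.elt (P := P)) hy⟩)

end

variable {E : Type u} [Category.{v} E] [PositiveHeytingCategory E] {S : MorphismProperty E}
  {C : InternalCategory E} {J : Topology S C} {B : ObjectOfSieves S C}
  (hS : IsClassOfSmallMaps S) (hC : S C.cod) (hB : J.IsPresentation B)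

include hS hC hB

/-- The covers of `E` are covering. -/
theorem isCovering_cart {T T' : E} (a : T ⟶ C.ob) (p : T' ⟶ T) (hp : IsRegularEpi p) :
    IsCovering B (principalSieve (Tot.cart a p)) := by
  obtain ⟨U, q, b, hq, hb⟩ := hB.exists_basic hS hC (p ≫ a)
  refine ⟨U, q ≫ p, b, isRegularEpi_comp _ _ hq hp, by simp [hb], fun V t f hf =>
    ⟨V, 𝟙 V, inferInstance, ?_, ?_⟩⟩
  · have := B.isSieve.cod_eq _ _ hf
    simp [this, hb]
  · exact (principalSieve_cart_arrows (X := ⟨T, a⟩) p _).2 ⟨t ≫ q, by simp [Tot.mk']⟩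

omit hS hC hB in
theorem isCovering_basic {T M : E} (a : T ⟶ C.ob) (b : T ⟶ B.K) (hb : b ≫ B.base = a)
    {f : M ⟶ C.mor} {m : M ⟶ T} (hM : B.IsMembers b f m) (h : f ≫ C.cod = m ≫ a) :
    IsCovering B (principalSieve (Tot.mk' (a := a) m f rfl h)) := by
  refine ⟨T, 𝟙 T, b, inferInstanceAs (IsRegularEpi (𝟙 T)), by simpa using hb, fun V t f' hf' =>
    ⟨V, 𝟙 V, inferInstance, ?_, ?_⟩⟩
  · have := B.isSieve.cod_eq _ _ hf'
    simp [this, hb]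
  · refine (hM.principalSieve_arrows (X := ⟨T, a⟩) h _).2 ?_
    simpa [Tot.mk'] using hf'

/-- Families of internal covering sieves are covering. -/
theorem isCovering_members {T M : E} (a : T ⟶ C.ob) (c : T ⟶ J.K) (hc : c ≫ J.base = a)
    {f : M ⟶ C.mor} {m : M ⟶ T} (hM : J.IsMembers c f m) (h : f ≫ C.cod = m ≫ a) :
    IsCovering B (principalSieve (Tot.mk' (a := a) m f rfl h)) := by
  obtain ⟨U, p, b, hp, hb, hbc⟩ := hB.exists_refinement hS hC c
  refine ⟨U, p, b, hp, by rw [hb, hc], fun V t f' hf' => ⟨V, 𝟙 V, inferInstance, ?_, ?_⟩⟩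
  · have := B.isSieve.cod_eq _ _ hf'
    simp [this, hb, hc]
  · refine (hM.principalSieve_arrows (X := ⟨T, a⟩) h _).2 ?_
    simpa [Tot.mk'] using hbc t f' hf'

theorem isSheaf_of_isSheaf_ext (P : Presheaf C)
    (hP : Presieve.IsSheaf (siteTopology hS hC hB) P.ext) : J.IsSheaf P := by
  intro T c x hx
  have hM : J.IsMembers c (J.arrow c) (J.index c) := J.isMembers_pullback c
  have h1 := (isSheafFor_principalSieve _).1
    (hP _ (isCovering_members hS hC hB (c ≫ J.base) c rfl hM (J.arrow_cod c)))
  let x' : P.Section ⟨_, J.arrow c ≫ C.dom⟩ := ⟨x, hx.σ_eq⟩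
  obtain ⟨z, hz, huniq⟩ := h1 x' (by
    intro ⟨U, b⟩ k₁ k₂ hk
    have hm : Mem J.sieve _ _ :=
      (hM.principalSieve_arrows (X := ⟨T, c ≫ J.base⟩) (J.arrow_cod c) _).1
        ((principalSieve_arrows _ _).2 ⟨k₁, rfl⟩)
    obtain ⟨y, ⟨hy1, hy2⟩, -⟩ := hM.existsUnique _ _ hm
    have e1 : (k₁.base ≫ J.arrow c) ≫ C.dom = k₁.arr ≫ C.cod := by
      rw [k₁.arr_cod, Category.assoc]
    have e2 : (k₂.base ≫ J.arrow c) ≫ C.dom = k₂.arr ≫ C.cod := by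
      rw [k₂.arr_cod, Category.assoc]
    have h2 := hx.compatible k₁.base y k₁.arr e1 hy2.symm hy1
    have h3 := hx.compatible k₂.base y k₂.arr e2
      ((congrArg Tot.Hom.base hk).symm.trans hy2.symm) (hy1.trans (congrArg Tot.Hom.arr hk))
    exact Presheaf.Section.ext (P := P) (h2.symm.trans h3))
  refine ⟨(show P.Section _ from z).elt,
    ⟨(show P.Section _ from z).elt_σ, congrArg (Presheaf.Section.elt (P := P)) hz⟩, ?_⟩
  rintro y ⟨hy, hyx⟩
  let y' : P.Section ⟨T, c ≫ J.base⟩ := ⟨y, hy⟩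
  exact congrArg (Presheaf.Section.elt (P := P))
    (huniq y' (Presheaf.Section.ext (P := P) hyx))

/-- An internal sheaf is a sheaf on the total category: the covers of `E` and the internal covering
sieves belong to the finest topology for which it is a sheaf, and they generate the topology. -/
theorem isSheaf_ext_of_isSheaf (P : Presheaf C) (hP : J.IsSheaf P) :
    Presieve.IsSheaf (siteTopology hS hC hB) P.ext := by
  intro X ρ hρ
  let T₀ := Sheaf.finestTopologySingle P.ext
  have hcart : ∀ {X : Tot C} {T : E} (p : T ⟶ X.base), IsRegularEpi p →
      principalSieve (Tot.cart X.ob p) ∈ T₀ X := by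
    intro X T p hp Y k
    have e : (principalSieve (Tot.cart X.ob p)).pullback k =
        principalSieve (Tot.cart Y.ob (pullback.fst k.base p)) := by
      ext Z l
      refine (principalSieve_cart_arrows _ _).trans
        (Iff.trans ⟨?_, ?_⟩ (principalSieve_cart_arrows _ _).symm)
      · rintro ⟨u, hu⟩
        exact ⟨pullback.lift l.base u hu.symm, by simp⟩
      · rintro ⟨u, hu⟩
        refine ⟨u ≫ pullback.snd _ _, ?_⟩
        rw [Category.assoc, ← pullback.condition, reassoc_of% hu]
        rfl
    rw [e]
    exact P.isSheafFor_ext_cart Y.ob _ inferInstance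
  have hbasic : ∀ {T M : E} (b : T ⟶ B.K) {f : M ⟶ C.mor} {m : M ⟶ T} (_ : B.IsMembers b f m)
      (h : f ≫ C.cod = m ≫ b ≫ B.base),
      principalSieve (Tot.mk' (a := b ≫ B.base) m f rfl h) ∈ T₀ ⟨T, b ≫ B.base⟩ := by
    intro T M b f m hM h Y k
    obtain ⟨c, hc, hcb⟩ := hB.exists_cov hS hC b
    obtain ⟨d, hd, hdc⟩ := J.stability (k.base ≫ c) k.arr (by
      rw [k.arr_cod, Category.assoc, hc])
    rw [k.arr_dom] at hd
    have hY : J.arrow d ≫ C.cod = J.index d ≫ Y.ob := by rw [J.arrow_cod, hd]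
    have e : (principalSieve (Tot.mk' (a := b ≫ B.base) m f rfl h)).pullback k =
        principalSieve (Tot.mk' (a := Y.ob) (J.index d) (J.arrow d) rfl hY) := by
      ext Z l
      refine (hM.principalSieve_arrows (X := ⟨T, b ≫ B.base⟩) h _).trans
        (Iff.trans ?_ ((J.isMembers_pullback d).principalSieve_arrows _ _).symm)
      have e1 : (l.base ≫ k.arr) ≫ C.dom = l.arr ≫ C.cod := by
        rw [Category.assoc, k.arr_dom, l.arr_cod]
      refine Iff.trans ?_ (hdc l.base l.arr e1).symm
      rw [← Category.assoc, hcb]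
      rfl
    rw [e]
    exact P.isSheafFor_ext_members hP Y.ob d hY hd
  suffices h : ρ ∈ T₀ X by simpa using h X (𝟙 X)
  obtain ⟨T, p, b, hp, hb, h⟩ := hρ
  refine T₀.transitive (hcart p hp) _ fun Y k hk => ?_
  obtain ⟨u, hu⟩ := (principalSieve_cart_arrows _ _).1 hk
  let k₀ : (⟨T, b ≫ B.base⟩ : Tot C) ⟶ X :=
    Tot.mk' (a := X.ob) p (p ≫ X.ob ≫ C.one) (by simp [C.one_dom, hb]) (by simp [C.one_cod])
  let l : Y ⟶ ⟨T, b ≫ B.base⟩ := Tot.mk' (b := Y.ob) (a := b ≫ B.base) u k.arr k.arr_dom (by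
    rw [hb, reassoc_of% hu, k.arr_cod])
  have hl : l ≫ k₀ = k := Tot.Hom.ext hu (C.one_compose' _ _ (by
    show u ≫ p ≫ X.ob ≫ C.one = k.arr ≫ C.cod ≫ C.one
    rw [reassoc_of% hu, reassoc_of% k.arr_cod]) _)
  rw [← hl, Sieve.pullback_comp]
  refine T₀.pullback_stable l ?_
  obtain ⟨M, f, m, -, hM⟩ := B.exists_members hS b
  have hcod : f ≫ C.cod = m ≫ b ≫ B.base := by
    rw [B.isSieve.cod_eq _ _ hM.mem, Category.assoc]
  refine T₀.transitive (hbasic b hM hcod) _ fun Z j hj => ?_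
  have hj' := (hM.principalSieve_arrows hcod j).1 hj
  obtain ⟨V, r, hr, hrρ⟩ := h _ _ hj'
  refine T₀.superset_covering ?_ (hcart r hr)
  intro W i hi
  obtain ⟨u', hu'⟩ := (principalSieve_cart_arrows _ _).1 hi
  have e1 : (u' ≫ r ≫ j.arr) ≫ C.dom = i.arr ≫ C.cod := by
    rw [i.arr_cod, ← hu']
    simp [j.arr_dom]
  refine (MemSieve.iff_arrows (ρ := ρ) ((i ≫ j) ≫ k₀)).2 ?_
  refine (hrρ.compose u' i.arr e1).congr ?_ ?_
  · show _ = (i.base ≫ j.base) ≫ p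
    rw [← hu']
    simp
  · show _ = C.compose ((i ≫ j).base ≫ p ≫ X.ob ≫ C.one) (i ≫ j).arr _
    refine Eq.trans ?_ (C.one_compose' (i ≫ j).arr _ ?_ _).symm
    · exact C.compose_congr (by rw [← hu', Category.assoc]) rfl _
    · rw [← Category.assoc _ C.cod, (i ≫ j).arr_cod]
      simp [hb]

end Sheaves

/-! ### Quotients of families of elements by their kernels -/

section Quotients

open Opposite

universe w

variable {E : Type u} [Category.{v} E] [PositiveHeytingCategory E] {C : InternalCategory E}

/-- A presheaf on the total category that is a sheaf for the covers of `E`. -/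
def IsCoverSheaf (F : (Tot C)ᵒᵖ ⥤ Type w) : Prop :=
  ∀ ⦃T T' : E⦄ (a : T ⟶ C.ob) (p : T' ⟶ T), IsRegularEpi p →
    Presieve.IsSheafFor F (principalSieve (Tot.cart a p)).arrows

namespace Elem

/-- A family of elements without repetitions. -/
def IsMonic {F : (Tot C)ᵒᵖ ⥤ Type w} {Y : E} (s : Elem F Y) : Prop :=
  ∀ ⦃T : E⦄ (z z' : T ⟶ Y), s.res z = s.res z' → z = z'

variable {F : (Tot C)ᵒᵖ ⥤ Type w} (hF : IsCoverSheaf F)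

include hF

theorem eq_of_res_eq {T T' : E} {p : T' ⟶ T} (hp : IsRegularEpi p) {s s' : Elem F T}
    (h : s.res p = s'.res p) : s = s' := by
  obtain ⟨a, x⟩ := s
  obtain ⟨a', x'⟩ := s'
  obtain rfl : a = a' := eq_of_cover hp (congrArg Elem.ob h)
  refine mk_inj.2 ((hF a p hp).isSeparatedFor.ext fun Y k hk => ?_)
  obtain ⟨l, rfl⟩ := (principalSieve_arrows _ _).1 hk
  have h1 : F.map (Tot.cart a p).op x = F.map (Tot.cart a p).op x' := mk_inj.1 h
  simp only [op_comp, Functor.map_comp_apply, h1]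

/-- Families of elements of a sheaf for the covers descend along covers. -/
theorem exists_glue {T T' : E} {p : T' ⟶ T} (hp : IsRegularEpi p) (s : Elem F T')
    (h : ∀ ⦃U : E⦄ (y z : U ⟶ T'), y ≫ p = z ≫ p → s.res y = s.res z) :
    ∃ s' : Elem F T, s'.res p = s := by
  obtain ⟨a', x⟩ := s
  obtain ⟨a, rfl⟩ := exists_desc_of_cover p hp a' fun U y z hyz => congrArg Elem.ob (h y z hyz)
  obtain ⟨x', hx', -⟩ := (isSheafFor_principalSieve _).1 (hF a p hp) x (by
    intro ⟨U, b⟩ l l' hl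
    apply mk_inj.1
    refine (along_eq_pull (⟨p ≫ a, x⟩ : Elem F T') l).trans (Eq.trans ?_
      (along_eq_pull (⟨p ≫ a, x⟩ : Elem F T') l').symm)
    have hb : l.base ≫ p = l'.base ≫ p := congrArg Tot.Hom.base hl
    have ha : l.arr = l'.arr := by
      have h1 := congrArg Tot.Hom.arr hl
      refine (C.one_compose' _ _ ?_ _).symm.trans (h1.trans (C.one_compose' _ _ ?_ _))
      · show l.base ≫ p ≫ a ≫ C.one = l.arr ≫ C.cod ≫ C.one
        rw [reassoc_of% l.arr_cod]
      · show l'.base ≫ p ≫ a ≫ C.one = l'.arr ≫ C.cod ≫ C.one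
        rw [reassoc_of% l'.arr_cod]
    have h2 := h _ _ hb
    have h3 : l.arr ≫ C.cod = 𝟙 U ≫ l.base ≫ p ≫ a := by rw [Category.id_comp, l.arr_cod]
    have h4 : l'.arr ≫ C.cod = 𝟙 U ≫ l'.base ≫ p ≫ a := by rw [Category.id_comp, l'.arr_cod]
    have h5 := res_pull (⟨p ≫ a, x⟩ : Elem F T') l.base (𝟙 U) l.arr h3
    have h6 := res_pull (⟨p ≫ a, x⟩ : Elem F T') l'.base (𝟙 U) l'.arr h4
    refine (pull_congr rfl (Category.id_comp _).symm rfl _).trans (h5.symm.trans (Eq.trans ?_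
      (h6.trans (pull_congr rfl (Category.id_comp _) rfl _))))
    exact pull_congr h2 rfl ha _)
  exact ⟨⟨a, x'⟩, mk_inj.2 hx'⟩

/-- A family of elements that locally is a reindexing of a monic family is a reindexing of it. -/
theorem IsMonic.exists_res_eq {T T' Y : E} {s : Elem F Y} (hs : s.IsMonic) {p : T' ⟶ T}
    (hp : IsRegularEpi p) {s' : Elem F T} (z : T' ⟶ Y) (h : s.res z = s'.res p) :
    ∃ y : T ⟶ Y, s.res y = s' := by
  obtain ⟨y, hy⟩ := exists_desc_of_cover p hp z fun U t t' ht => by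
    apply hs
    rw [← res_res, ← res_res, h, res_res, res_res, ht]
  refine ⟨y, eq_of_res_eq hF hp ?_⟩
  rw [res_res, hy, h]

/-- A family of elements whose kernel is bounded factors as a cover followed by a monic family. -/
theorem exists_quotient {S : MorphismProperty E} (hS : IsPredicative S) {X : E} (s : Elem F X)
    (hs : IsBounded S fun U (t : U ⟶ X ⨯ X) => s.res (t ≫ prod.fst) = s.res (t ≫ prod.snd)) :
    ∃ (Q : E) (q : X ⟶ Q) (s' : Elem F Q), IsRegularEpi q ∧ s'.res q = s ∧ s'.IsMonic := by
  obtain ⟨R, hR, h⟩ := hs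
  have h' : ∀ ⦃T : E⦄ (x y : T ⟶ X), R.Factors (prod.lift x y) ↔ s.res x = s.res y := by
    intro T x y
    refine (h _).trans ?_
    simp only [prod.lift_fst, prod.lift_snd]
  obtain ⟨Q, q, hk, hq, -⟩ := hS.boundedExactness R (fun T =>
    ⟨fun x => (h' _ _).2 rfl, fun hxy => (h' _ _).2 ((h' _ _).1 hxy).symm,
      fun hxy hyz => (h' _ _).2 (((h' _ _).1 hxy).trans ((h' _ _).1 hyz))⟩) hR
  have hker : ∀ ⦃T : E⦄ (x y : T ⟶ X), x ≫ q = y ≫ q ↔ s.res x = s.res y := by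
    intro T x y
    rw [← h']
    constructor
    · intro hxy
      have e : IsPullback.lift hk x y hxy ≫ R.arrow = prod.lift x y := by
        ext
        · rw [Category.assoc, prod.lift_fst]
          exact hk.lift_fst _ _ _
        · rw [Category.assoc, prod.lift_snd]
          exact hk.lift_snd _ _ _
      rw [← e]
      exact Subobject.factors_comp_arrow _
    · intro hxy
      obtain ⟨k, e⟩ : ∃ k, k ≫ R.arrow = prod.lift x y := ⟨_, R.factorThru_arrow _ hxy⟩
      have e1 := e =≫ prod.fst
      have e2 := e =≫ prod.snd
      rw [Category.assoc, prod.lift_fst] at e1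
      rw [Category.assoc, prod.lift_snd] at e2
      rw [← e1, ← e2]
      simpa only [Category.assoc] using k ≫= hk.w
  obtain ⟨s', hs'⟩ := exists_glue hF hq s fun U y z hyz => (hker y z).1 hyz
  refine ⟨Q, q, s', hq, hs', fun T z z' hz => ?_⟩
  obtain ⟨V, r, y, hr, hy⟩ := exists_cover_lift q hq z
  obtain ⟨V', r', y', hr', hy'⟩ := exists_cover_lift q hq (r ≫ z')
  refine eq_of_cover (isRegularEpi_comp _ _ hr' hr) ?_
  rw [Category.assoc, ← hy, Category.assoc, ← hy', ← Category.assoc, hker, ← hs', res_res, res_res,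
    Category.assoc, hy, hy', ← Category.assoc, ← Category.assoc, ← res_res, hz, res_res]

end Elem

end Quotients

/-! ### Families of elements of a sheaf on the site -/

section SiteSheaves

open Opposite

universe w

variable {E : Type u} [Category.{v} E] [PositiveHeytingCategory E] {S : MorphismProperty E}
  {C : InternalCategory E} {J : Topology S C} {B : ObjectOfSieves S C}
  {hS : IsClassOfSmallMaps S} {hC : S C.cod} {hB : J.IsPresentation B}
  {F : (Tot C)ᵒᵖ ⥤ Type w} (hF : Presieve.IsSheaf (siteTopology hS hC hB) F)

include hF

namespace Elem

theorem isCoverSheaf : IsCoverSheaf F := fun _ _ a p hp =>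
  hF _ (isCovering_cart hS hC hB a p hp)

/-- Two families of elements of a sheaf over the same family of objects are equal if they agree on a
covering sieve. -/
theorem eq_of_isCovering {T : E} {s s' : Elem F T} (hob : s.ob = s'.ob)
    {ρ : Sieve (⟨T, s.ob⟩ : Tot C)} (hρ : IsCovering B ρ)
    (h : ∀ ⦃U : E⦄ (t : U ⟶ T) (f : U ⟶ C.mor) (hf : f ≫ C.cod = t ≫ s.ob), MemSieve ρ t f →
      s.pull t f hf = s'.pull t f (by rw [← hob, hf])) : s = s' := by
  obtain ⟨a, x⟩ := s
  obtain ⟨a', x'⟩ := s'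
  obtain rfl : a = a' := hob
  refine mk_inj.2 ((hF _ hρ).isSeparatedFor.ext fun Y k hk => (mk_inj (a := Y.ob)).1 ?_)
  exact (along_eq_pull (⟨a, x⟩ : Elem F T) k).trans
    ((h k.base k.arr k.arr_cod ((MemSieve.iff_arrows k).1 hk)).trans
      (along_eq_pull (⟨a, x'⟩ : Elem F T) k).symm)

theorem eq_of_basic {T : E} {s s' : Elem F T} (b : T ⟶ B.K) (hb : b ≫ B.base = s.ob)
    (hob : s.ob = s'.ob)
    (h : ∀ ⦃U : E⦄ (t : U ⟶ T) (f : U ⟶ C.mor) (hf : f ≫ C.cod = t ≫ s.ob),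
      Mem B.sieve f (t ≫ b) → s.pull t f hf = s'.pull t f (by rw [← hob, hf])) : s = s' := by
  obtain ⟨M, f, m, -, hM⟩ := B.exists_members hS b
  have hf : f ≫ C.cod = m ≫ s.ob := by
    rw [B.isSieve.cod_eq _ _ hM.mem, Category.assoc, hb]
  exact eq_of_isCovering hF hob (isCovering_basic s.ob b hb hM hf) fun U t f' hf' ⟨_, hm⟩ =>
    h t f' hf' ((hM.principalSieve_arrows (X := ⟨T, s.ob⟩) hf _).1 hm)

/-- Matching families on a basic sieve have an amalgamation. -/
theorem exists_amalgamation {T M : E} (b : T ⟶ B.K) {f : M ⟶ C.mor} {m : M ⟶ T}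
    (hM : B.IsMembers b f m) (x : Elem F M) (hx : x.ob = f ≫ C.dom)
    (h : ∀ ⦃U : E⦄ (y y' : U ⟶ M) (g : U ⟶ C.mor) (hg : g ≫ C.cod = y ≫ x.ob)
      (hg' : (y ≫ f) ≫ C.dom = g ≫ C.cod), y ≫ m = y' ≫ m →
      y' ≫ f = C.compose (y ≫ f) g hg' → x.pull y g hg = x.res y') :
    ∃ s : Elem F T, s.ob = b ≫ B.base ∧
      ∀ hf : f ≫ C.cod = m ≫ s.ob, s.pull m f hf = x := by
  obtain ⟨o, x⟩ := x
  obtain rfl : o = f ≫ C.dom := hx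
  have hf : f ≫ C.cod = m ≫ b ≫ B.base := by
    rw [B.isSieve.cod_eq _ _ hM.mem, Category.assoc]
  obtain ⟨s, hs, -⟩ := (isSheafFor_principalSieve _).1
    (hF _ (isCovering_basic (b ≫ B.base) b rfl hM hf)) x (by
      intro ⟨U, c⟩ l l' hl
      have hm := (hM.principalSieve_arrows (X := ⟨T, b ≫ B.base⟩) hf _).1
        ((principalSieve_arrows _ _).2 ⟨l, rfl⟩)
      obtain ⟨y, ⟨hy1, hy2⟩, -⟩ := hM.existsUnique _ _ hm
      have e1 : (l.base ≫ f) ≫ C.dom = l.arr ≫ C.cod := by rw [l.arr_cod, Category.assoc]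
      have e2 : (l'.base ≫ f) ≫ C.dom = l'.arr ≫ C.cod := by rw [l'.arr_cod, Category.assoc]
      apply mk_inj.1
      refine (along_eq_pull (⟨f ≫ C.dom, x⟩ : Elem F M) l).trans (Eq.trans ?_
        (along_eq_pull (⟨f ≫ C.dom, x⟩ : Elem F M) l').symm)
      exact (h l.base y l.arr l.arr_cod e1 hy2.symm hy1).trans
        (h l'.base y l'.arr l'.arr_cod e2 ((congrArg Tot.Hom.base hl).symm.trans hy2.symm)
          (hy1.trans (congrArg Tot.Hom.arr hl))).symm)
  exact ⟨⟨b ≫ B.base, s⟩, rfl, fun _ => mk_inj.2 hs⟩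

end Elem

end SiteSheaves

/-! ### The object of matching families -/

section Matching

variable {E : Type u} [Category.{v} E] [PositiveHeytingCategory E] {S : MorphismProperty E}
  {C : InternalCategory E}

/-- The object of sections over the fibres of an exponentiable map `m`: a section of `w` over the
fibres of `m` indexed by `β` is given by a map to this object over `β`. -/
theorem exists_object_of_sections {B M W : E} (m : M ⟶ B) [(Over.pullback m).IsLeftAdjoint]
    (w : W ⟶ M) :
    ∃ (G : E) (γ : G ⟶ B) (ev : pullback γ m ⟶ W), ev ≫ w = pullback.snd γ m ∧
      ∀ ⦃T : E⦄ (β : T ⟶ B) (x : pullback β m ⟶ W), x ≫ w = pullback.snd β m →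
        ∃ g : T ⟶ G, g ≫ γ = β ∧ ∀ ⦃V : E⦄ (r : V ⟶ T) (e : V ⟶ pullback γ m)
          (h : r ≫ β = (e ≫ pullback.snd γ m) ≫ m), e ≫ pullback.fst γ m = r ≫ g →
          e ≫ ev = pullback.lift r (e ≫ pullback.snd γ m) h ≫ x := by
  let adj := Adjunction.ofIsLeftAdjoint (Over.pullback m)
  let R := (Over.pullback m).rightAdjoint.obj (Over.mk w)
  refine ⟨R.left, R.hom, (adj.counit.app (Over.mk w)).left, Over.w (adj.counit.app (Over.mk w)),
    fun T β x hx => ?_⟩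
  let x' : (Over.pullback m).obj (Over.mk β) ⟶ Over.mk w := Over.homMk x hx
  let g := adj.homEquiv _ _ x'
  have hg : (Over.pullback m).map g ≫ adj.counit.app (Over.mk w) = x' :=
    (adj.homEquiv_counit _ _ g).symm.trans ((adj.homEquiv _ _).symm_apply_apply x')
  refine ⟨g.left, Over.w g, fun V r e h he => ?_⟩
  have h1 : ((Over.pullback m).map g).left ≫ (adj.counit.app (Over.mk w)).left = x :=
    congrArg CommaMorphism.left hg
  rw [← h1, ← Category.assoc]
  congr 1
  apply pullback.hom_ext
  · refine he.trans (Eq.trans ?_ (Category.assoc _ _ _).symm)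
    exact (pullback.lift_fst_assoc _ _ _ _).symm.trans (congrArg _ (pullback.lift_fst _ _ _).symm)
  · refine Eq.trans ?_ (Category.assoc _ _ _).symm
    exact (pullback.lift_snd _ _ _).symm.trans (congrArg _ (pullback.lift_snd _ _ _).symm)

namespace ObjectOfSieves.IsMembers

variable {O : ObjectOfSieves S C} {T M : E} {c : T ⟶ O.K} {f : M ⟶ C.mor} {m : M ⟶ T}

theorem hom_ext (hM : O.IsMembers c f m) {U : E} {y y' : U ⟶ M} (hf : y ≫ f = y' ≫ f)
    (hm : y ≫ m = y' ≫ m) : y = y' :=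
  (hM.existsUnique _ _ (O.mem_comp y' hM.mem)).unique ⟨hf, hm⟩ ⟨rfl, rfl⟩

theorem pullback (hM : O.IsMembers c f m) {T' : E} (t : T' ⟶ T) :
    O.IsMembers (t ≫ c) (pullback.snd t m ≫ f) (pullback.fst t m) := by
  refine ⟨?_, fun U g s h => ?_⟩
  · rw [pullback.condition_assoc, ← Category.assoc]
    exact O.mem_comp _ hM.mem
  · rw [← Category.assoc] at h
    obtain ⟨k, ⟨hk1, hk2⟩, hk⟩ := hM.existsUnique _ _ h
    refine ⟨pullback.lift s k hk2.symm, ⟨by simp [hk1], by simp⟩, ?_⟩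
    rintro l ⟨hl1, hl2⟩
    apply pullback.hom_ext
    · simpa using hl2
    · rw [pullback.lift_snd]
      exact hk _ ⟨by simpa using hl1, by simp [← hl2, pullback.condition]⟩

end ObjectOfSieves.IsMembers

/-- A matching family: an element of `P` over the domain of `f` for all members `f` of a sieve,
such that restriction corresponds to precomposition. -/
structure PresheafData.IsMatching (P : PresheafData C) {T M : E} (f : M ⟶ C.mor) (m : M ⟶ T)
    (x : M ⟶ P.X) : Prop where
  σ_eq : x ≫ P.σ = f ≫ C.dom
  matching : ∀ ⦃U : E⦄ (y y' : U ⟶ M) (k : U ⟶ C.mor) (h : (y ≫ f) ≫ C.dom = k ≫ C.cod),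
    y ≫ m = y' ≫ m → y' ≫ f = C.compose (y ≫ f) k h →
    y' ≫ x = P.res (y ≫ x) k (by rw [← h, Category.assoc, σ_eq, Category.assoc])

/-- The object of matching families on the sieves in `O`: an exponential cut down by a universal
quantification. -/
theorem PresheafData.exists_object_of_matching (hS : IsPredicative S) (O : ObjectOfSieves S C)
    (P : PresheafData C) :
    ∃ (G N : E) (β : G ⟶ O.K) (f : N ⟶ C.mor) (m : N ⟶ G) (x : N ⟶ P.X), S m ∧
      O.IsMembers β f m ∧ P.IsMatching f m x ∧
      ∀ ⦃T M : E⦄ (b : T ⟶ O.K) (f' : M ⟶ C.mor) (m' : M ⟶ T) (x' : M ⟶ P.X),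
        O.IsMembers b f' m' → P.IsMatching f' m' x' →
        ∃ g : T ⟶ G, g ≫ β = b ∧ ∀ ⦃U : E⦄ (y : U ⟶ M) (y' : U ⟶ N),
          y' ≫ m = y ≫ m' ≫ g → y' ≫ f = y ≫ f' → y' ≫ x = y ≫ x' := by
  obtain ⟨M₀, f₀, m₀, hm₀, hM₀⟩ := O.exists_members hS.toIsClassOfSmallMaps (𝟙 O.K)
  have := hS.exponentiable m₀ hm₀
  obtain ⟨G₀, γ, ev, hev, huniv⟩ := exists_object_of_sections m₀ (pullback.snd P.σ (f₀ ≫ C.dom))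
  have hN₀ := hM₀.pullback γ
  rw [Category.comp_id] at hN₀
  -- `e` is the generic member, `k` a generic arrow composable with it and `e'` the composite.
  let D := Limits.pullback (pullback.snd γ m₀ ≫ f₀ ≫ C.dom) C.cod
  let e : D ⟶ Limits.pullback γ m₀ := pullback.fst _ _
  let k : D ⟶ C.mor := pullback.snd _ _
  have hek : (e ≫ pullback.snd γ m₀ ≫ f₀) ≫ C.dom = k ≫ C.cod := by
    have := pullback.condition (f := pullback.snd γ m₀ ≫ f₀ ≫ C.dom) (g := C.cod)
    simpa [e, k] using this
  obtain ⟨e', ⟨he'1, he'2⟩, -⟩ := hN₀.existsUnique _ _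
    (O.isSieve.closed _ k _ hek (O.mem_comp e hN₀.mem))
  let x₀ : Limits.pullback γ m₀ ⟶ P.X := ev ≫ pullback.fst _ _
  have hx₀ : x₀ ≫ P.σ = pullback.snd γ m₀ ≫ f₀ ≫ C.dom := by
    simp only [x₀, Category.assoc]
    rw [pullback.condition, reassoc_of% hev]
  have hxk : (e ≫ x₀) ≫ P.σ = k ≫ C.cod := by rw [Category.assoc, hx₀, ← hek]; simp
  -- `A` consists of the families that match: for all members `e` and all `k`, the value at the
  -- composite is the restriction along `k` of the value at `e`.
  obtain ⟨A, -, hA⟩ := exists_forall_factors (e ≫ pullback.fst γ m₀)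
    (equalizerSubobject (e' ≫ x₀) (P.res (e ≫ x₀) k hxk))
  simp only [equalizerSubobject_factors_iff] at hA
  have hN := hN₀.pullback A.arrow
  refine ⟨_, _, A.arrow ≫ γ, _, pullback.fst A.arrow (pullback.fst γ m₀), pullback.snd _ _ ≫ x₀,
    hS.toIsClassOfSmallMaps.pullback_fst _ _ (hS.toIsClassOfSmallMaps.pullback_fst _ _ hm₀), hN,
    ⟨by simp [hx₀], fun U y y' l hl hm hf => ?_⟩, fun T M b f' m' x' hM hx' => ?_⟩
  · have h1 := (hA A.arrow).1 (by simpa using Subobject.factors_comp_arrow (P := A) (𝟙 _))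
    let z : U ⟶ D := pullback.lift (y ≫ pullback.snd _ _) l (by simpa using hl)
    have hze : z ≫ e = y ≫ pullback.snd _ _ := pullback.lift_fst _ _ _
    have hzk : z ≫ k = l := pullback.lift_snd _ _ _
    have h2 := h1 (y ≫ pullback.fst _ _) z (by
      rw [reassoc_of% hze, Category.assoc, pullback.condition])
    have hze' : z ≫ e' = y' ≫ pullback.snd _ _ := by
      refine hN₀.hom_ext ?_ ?_
      · rw [Category.assoc, he'1, C.comp_compose]
        refine Eq.trans ?_ (hf.symm.trans (Category.assoc _ _ _).symm)
        exact C.compose_congr (by rw [reassoc_of% hze]) hzk _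
      · rw [Category.assoc, he'2, reassoc_of% hze, Category.assoc, ← pullback.condition,
          reassoc_of% hm, pullback.condition]
    rw [reassoc_of% hze', P.comp_res] at h2
    rw [h2]
    exact P.res_congr (by rw [reassoc_of% hze]) hzk _
  · -- Transport the family from `M` to the members of `b` obtained by pulling back `M₀`.
    have hM' := hM₀.pullback b
    rw [Category.comp_id] at hM'
    obtain ⟨j, ⟨hj1, hj2⟩, -⟩ := hM.existsUnique _ _ hM'.mem
    obtain ⟨g, hg, hgev⟩ := huniv b (pullback.lift (j ≫ x') (pullback.snd _ _) (by
      rw [Category.assoc, hx'.σ_eq, reassoc_of% hj1])) (by simp)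
    have key : ∀ ⦃V : E⦄ (y : V ⟶ M) (n : V ⟶ Limits.pullback γ m₀),
        n ≫ pullback.fst γ m₀ = y ≫ m' ≫ g → n ≫ pullback.snd γ m₀ ≫ f₀ = y ≫ f' →
        n ≫ x₀ = y ≫ x' := by
      intro V y n h1 h2
      have h3 : (y ≫ m') ≫ b = (n ≫ pullback.snd γ m₀) ≫ m₀ := by
        rw [← hg, Category.assoc, ← reassoc_of% h1, pullback.condition, Category.assoc]
      have h4 := hgev (y ≫ m') n h3 (by rw [h1, Category.assoc])
      have h5 := h4 =≫ pullback.fst _ _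
      simp only [Category.assoc, pullback.lift_fst] at h5
      refine h5.trans ?_
      rw [← Category.assoc]
      congr 1
      refine hM.hom_ext ?_ ?_
      · rw [Category.assoc, hj1, pullback.lift_snd_assoc, Category.assoc, h2]
      · rw [Category.assoc, hj2, pullback.lift_fst]
    have hAg : A.Factors g := (hA g).2 fun V r z hz => by
      have hze : Mem O.sieve (z ≫ e ≫ pullback.snd γ m₀ ≫ f₀) (r ≫ b) := by
        have := O.mem_comp (z ≫ e) hN₀.mem
        simp only [Category.assoc] at this hz
        rwa [reassoc_of% hz, hg] at this
      obtain ⟨y, ⟨hy1, hy2⟩, -⟩ := hM.existsUnique _ _ hze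
      have hl : (y ≫ f') ≫ C.dom = (z ≫ k) ≫ C.cod := by
        rw [hy1]
        simpa using z ≫= hek
      have hze' : Mem O.sieve (C.compose (y ≫ f') (z ≫ k) hl) (r ≫ b) :=
        O.isSieve.closed _ _ _ _ (hy1 ▸ hze)
      obtain ⟨y', ⟨hy'1, hy'2⟩, -⟩ := hM.existsUnique _ _ hze'
      have h1 := key y (z ≫ e) (by rw [← Category.assoc, hy2, ← hz]; simp) (by rw [hy1]; simp)
      have h2 := key y' (z ≫ e') (by
        rw [Category.assoc, he'2, reassoc_of% hy'2, ← hz]) (by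
        rw [Category.assoc, he'1, hy'1, C.comp_compose]
        exact C.compose_congr hy1.symm rfl _)
      rw [← Category.assoc, h2, hx'.matching y y' (z ≫ k) hl (by rw [hy2, hy'2]) hy'1, P.comp_res]
      exact P.res_congr (by rw [← h1, Category.assoc]) rfl _
    refine ⟨A.factorThru g hAg, by simp [hg], fun U y y' h1 h2 => ?_⟩
    rw [← Category.assoc]
    refine key y _ ?_ (by simpa using h2)
    rw [Category.assoc, ← pullback.condition, reassoc_of% h1, Subobject.factorThru_arrow]

end Matching

/-! ### Locally injective and locally surjective morphisms from internal presheaves -/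

section AssociatedSheaf

open Opposite

variable {E : Type u} [Category.{v} E] [PositiveHeytingCategory E] {S : MorphismProperty E}
  {C : InternalCategory E} {J : Topology S C} {B : ObjectOfSieves S C}

theorem IsClassOfSmallMaps.equalizer_ι (hS : IsClassOfSmallMaps S) {X Y : E} (f g : X ⟶ Y) :
    S (equalizer.ι f g) :=
  hS.of_isPullback (isPullback_equalizer_prod f g) (hS.diagonals Y)

/-- A locally injective morphism from an internal presheaf: if two families of elements become
equal, then locally they agree on the members of a basic sieve. -/
theorem exists_basic_of_map_eq {hS : IsClassOfSmallMaps S} {hC : S C.cod} {hB : J.IsPresentation B}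
    {P : Presheaf C} {F : (Tot C)ᵒᵖ ⥤ Type (max u v)} (η : P.ext ⟶ F)
    [CategoryTheory.Presheaf.IsLocallyInjective (siteTopology hS hC hB) η] {T : E} {z z' : T ⟶ P.X}
    (h : (P.elem z).map η = (P.elem z').map η) :
    z ≫ P.σ = z' ≫ P.σ ∧ ∃ (T' : E) (p : T' ⟶ T) (b : T' ⟶ B.K), IsRegularEpi p ∧
      b ≫ B.base = p ≫ z ≫ P.σ ∧ ∀ ⦃U : E⦄ (t : U ⟶ T') (f : U ⟶ C.mor)
        (hf : (t ≫ p ≫ z) ≫ P.σ = f ≫ C.cod) (hf' : (t ≫ p ≫ z') ≫ P.σ = f ≫ C.cod),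
        Mem B.sieve f (t ≫ b) → P.res (t ≫ p ≫ z) f hf = P.res (t ≫ p ≫ z') f hf' := by
  have hσ : z ≫ P.σ = z' ≫ P.σ := congrArg Elem.ob h
  let x : P.Section ⟨T, z ≫ P.σ⟩ := ⟨z, rfl⟩
  let x' : P.Section ⟨T, z ≫ P.σ⟩ := ⟨z', hσ.symm⟩
  have hx : η.app (op ⟨T, z ≫ P.σ⟩) x = η.app _ x' := by
    have h' : (⟨_, x'⟩ : Elem P.ext T) = P.elem z' := Presheaf.mk_eq_elem P _ x'
    rw [← h'] at h
    exact Elem.mk_inj.1 h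
  obtain ⟨T', p, b, hp, hb, hpb⟩ : IsCovering B _ :=
    CategoryTheory.Presheaf.equalizerSieve_mem (siteTopology hS hC hB) η x x' hx
  refine ⟨hσ, T', p, b, hp, hb, fun U t f hf hf' hm => ?_⟩
  obtain ⟨V, r, hr, h1, h2⟩ := hpb t f hm
  apply eq_of_cover hr
  have h3 : P.res ((r ≫ t ≫ p) ≫ z) (r ≫ f) _ = P.res ((r ≫ t ≫ p) ≫ z') (r ≫ f) _ :=
    congrArg (fun s : P.Section _ => s.elt) h2
  rw [P.comp_res, P.comp_res]
  exact (P.res_congr (by simp) rfl _).trans (h3.trans (P.res_congr (by simp) rfl _))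

/-- A locally surjective morphism from an internal presheaf: locally, the restrictions of a family
of elements to the members of a basic sieve are in the image, on a cover. -/
theorem exists_basic_of_isLocallySurjective {hS : IsClassOfSmallMaps S} {hC : S C.cod}
    {hB : J.IsPresentation B} {P : Presheaf C} {F : (Tot C)ᵒᵖ ⥤ Type (max u v)} (η : P.ext ⟶ F)
    [CategoryTheory.Presheaf.IsLocallySurjective (siteTopology hS hC hB) η] {T : E}
    (s : Elem F T) : ∃ (T' : E) (p : T' ⟶ T) (b : T' ⟶ B.K), IsRegularEpi p ∧
      b ≫ B.base = p ≫ s.ob ∧ ∀ ⦃U : E⦄ (t : U ⟶ T') (f : U ⟶ C.mor)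
        (hf : f ≫ C.cod = (t ≫ p) ≫ s.ob), Mem B.sieve f (t ≫ b) →
        ∃ (V : E) (r : V ⟶ U) (z : V ⟶ P.X), IsRegularEpi r ∧
          (P.elem z).map η = (s.pull (t ≫ p) f hf).res r := by
  obtain ⟨a, x⟩ := s
  obtain ⟨T', p, b, hp, hb, hpb⟩ : IsCovering B _ :=
    CategoryTheory.Presheaf.imageSieve_mem (siteTopology hS hC hB) η (U := op ⟨T, a⟩) x
  refine ⟨T', p, b, hp, hb, fun U t f hf hm => ?_⟩
  obtain ⟨V, r, hr, h1, y, h2⟩ := hpb t f hm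
  obtain ⟨z, hz⟩ := P.exists_elem ⟨_, y⟩
  refine ⟨V, r, z, hr, ?_⟩
  rw [← hz, Elem.pull_res]
  exact Elem.mk_inj.2 h2

/-- The kernel of a locally injective morphism from an internal presheaf to a sheaf is bounded: two
elements have the same image precisely when there is a basic sieve on all of whose members they
agree, and basic sieves, their members and equality are small. -/
theorem isBounded_map_elem_eq {hS : IsClassOfSmallMaps S} {hC : S C.cod} {hB : J.IsPresentation B}
    {P : Presheaf C} {F : (Tot C)ᵒᵖ ⥤ Type (max u v)}
    (hF : Presieve.IsSheaf (siteTopology hS hC hB) F) (η : P.ext ⟶ F)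
    [CategoryTheory.Presheaf.IsLocallyInjective (siteTopology hS hC hB) η] :
    IsBounded S fun U (t : U ⟶ P.X ⨯ P.X) =>
      (P.elem (t ≫ prod.fst)).map η = (P.elem (t ≫ prod.snd)).map η := by
  -- On pairs of elements over the same object there is the object of basic sieves on that object,
  -- and over it the object `M` of their members.
  let ι := equalizer.ι ((prod.fst : P.X ⨯ P.X ⟶ P.X) ≫ P.σ) (prod.snd ≫ P.σ)
  have hι : ι ≫ prod.fst ≫ P.σ = ι ≫ prod.snd ≫ P.σ := equalizer.condition _ _
  let d := pullback.fst (ι ≫ prod.fst ≫ P.σ) B.base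
  let c := pullback.snd (ι ≫ prod.fst ≫ P.σ) B.base
  have hd : d ≫ ι ≫ prod.fst ≫ P.σ = c ≫ B.base := pullback.condition
  obtain ⟨M, f, m, hm, hM⟩ := B.exists_members hS c
  have hf := B.isSieve.cod_eq _ _ hM.mem
  have h1 : (m ≫ d ≫ ι ≫ prod.fst) ≫ P.σ = f ≫ C.cod := by simp [hf, ← hd]
  have h2 : (m ≫ d ≫ ι ≫ prod.snd) ≫ P.σ = f ≫ C.cod := by simp [hf, ← hd, hι]
  refine ((((IsBounded.eq hS (P.res _ f h1) (P.res _ f h2)).all hS m hm).ex hS d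
    (hS.pullback_fst _ _ hB.small)).map hS ι (hS.equalizer_ι _ _)).congr fun U t => ⟨?_, ?_⟩
  · rintro ⟨z, rfl, V, r, y, hr, hy, h⟩
    have e1 : (y ≫ c) ≫ B.base = ((P.elem (r ≫ (z ≫ ι) ≫ prod.fst)).map η).ob := by
      simp only [Elem.map_ob, Presheaf.elem_ob, Category.assoc]
      rw [← hd, reassoc_of% hy]
    have e2 : ((P.elem (r ≫ (z ≫ ι) ≫ prod.fst)).map η).ob =
        ((P.elem (r ≫ (z ≫ ι) ≫ prod.snd)).map η).ob := by
      simp only [Elem.map_ob, Presheaf.elem_ob, Category.assoc, hι]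
    refine Elem.eq_of_res_eq (Elem.isCoverSheaf hF) hr ?_
    rw [Elem.map_res, Elem.map_res, Presheaf.elem_res, Presheaf.elem_res]
    refine Elem.eq_of_basic hF (y ≫ c) e1 e2 fun W w f' hf' hmem => ?_
    rw [Elem.map_pull, Elem.map_pull]
    refine (congrArg (Elem.map η) (P.elem_pull _ w f' hf')).trans (Eq.trans ?_
      (congrArg (Elem.map η) (P.elem_pull _ w f' (hf'.trans (w ≫= e2)))).symm)
    rw [← Category.assoc] at hmem
    obtain ⟨k, ⟨hk1, hk2⟩, -⟩ := hM.existsUnique _ _ hmem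
    have h3 := h w k hk2
    rw [P.comp_res, P.comp_res] at h3
    congr 2
    refine (P.res_congr ?_ hk1.symm _).trans (h3.trans (P.res_congr ?_ hk1 _))
    · rw [reassoc_of% hk2, reassoc_of% hy, Category.assoc]
    · rw [reassoc_of% hk2, reassoc_of% hy, Category.assoc]
  · intro h
    obtain ⟨hσ, T', p, b, hp, hb, h'⟩ := exists_basic_of_map_eq (hS := hS) (hC := hC) (hB := hB) η h
    have e1 : equalizer.lift t (by simpa using hσ) ≫ ι = t := equalizer.lift_ι _ _
    refine ⟨equalizer.lift t (by simpa using hσ), e1, T', p,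
      pullback.lift (p ≫ equalizer.lift t (by simpa using hσ)) b (by
        rw [hb, Category.assoc, reassoc_of% e1, Category.assoc]), hp, pullback.lift_fst _ _ _,
      fun V r k hk => ?_⟩
    have hkc : k ≫ m ≫ c = r ≫ b := by rw [reassoc_of% hk, pullback.lift_snd]
    have hkd : k ≫ m ≫ d ≫ ι = r ≫ p ≫ t := by
      rw [reassoc_of% hk, pullback.lift_fst_assoc, Category.assoc, e1]
    have hmem := B.mem_comp k hM.mem
    rw [Category.assoc, hkc] at hmem
    rw [P.comp_res, P.comp_res]
    have e2 : k ≫ m ≫ d ≫ ι ≫ prod.fst = r ≫ p ≫ t ≫ prod.fst := by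
      simpa only [Category.assoc] using hkd =≫ prod.fst
    have e3 : k ≫ m ≫ d ≫ ι ≫ prod.snd = r ≫ p ≫ t ≫ prod.snd := by
      simpa only [Category.assoc] using hkd =≫ prod.snd
    refine (P.res_congr e2 rfl _).trans ((h' r (k ≫ f) ?_ ?_ hmem).trans
      (P.res_congr e3.symm rfl _))
    · rw [← e2, Category.assoc k, Category.assoc k, h1]
    · rw [← e3, Category.assoc k, Category.assoc k, h2]

end AssociatedSheaf

/-! ### Sheaves generated by a monic family -/

section Generators

variable {E : Type u} [Category.{v} E] [PositiveHeytingCategory E] {S : MorphismProperty E}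
  {C : InternalCategory E} {J : Topology S C} {B : ObjectOfSieves S C}

variable (B) in
/-- The family `s` generates the presheaf `F`: after passing to a cover, every element of `F`
restricts to members of `s` along all members of some basic sieve. -/
def Elem.IsGenerating {F : (Tot C)ᵒᵖ ⥤ Type (max u v)} {Q : E} (s : Elem F Q) : Prop :=
  ∀ ⦃T : E⦄ (s' : Elem F T), ∃ (T' : E) (p : T' ⟶ T) (b : T' ⟶ B.K), IsRegularEpi p ∧
    b ≫ B.base = p ≫ s'.ob ∧ ∀ ⦃U : E⦄ (t : U ⟶ T') (f : U ⟶ C.mor)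
      (hf : f ≫ C.cod = (t ≫ p) ≫ s'.ob), Mem B.sieve f (t ≫ b) →
      ∃ y : U ⟶ Q, s.res y = s'.pull (t ≫ p) f hf

/-- The associated sheaf of an internal presheaf has a monic generating family that is closed under
the action of `C`, namely the image of the presheaf. -/
theorem exists_isMonic_isGenerating (hS : IsPredicative S) {hC : S C.cod} {hB : J.IsPresentation B}
    {P : Presheaf C} {F : (Tot C)ᵒᵖ ⥤ Type (max u v)}
    (hF : Presieve.IsSheaf (siteTopology hS.toIsClassOfSmallMaps hC hB) F) (η : P.ext ⟶ F)
    [CategoryTheory.Presheaf.IsLocallyInjective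
      (siteTopology hS.toIsClassOfSmallMaps hC hB) η]
    [CategoryTheory.Presheaf.IsLocallySurjective
      (siteTopology hS.toIsClassOfSmallMaps hC hB) η] :
    ∃ (Q : E) (s : Elem F Q), s.IsMonic ∧ s.IsGenerating B ∧
      ∃ α : pullback s.ob C.cod ⟶ Q, s.res α =
        s.pull (pullback.fst _ _) (pullback.snd _ _) pullback.condition.symm := by
  have hF' := Elem.isCoverSheaf hF
  obtain ⟨Q, q, s, hq, hqs, hs⟩ := Elem.exists_quotient hF' hS ((P.elem (𝟙 P.X)).map η)
    ((isBounded_map_elem_eq hF η).congr fun U t => by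
      rw [← Presheaf.map_elem, ← Presheaf.map_elem])
  have key : ∀ ⦃T : E⦄ (z : T ⟶ P.X), s.res (z ≫ q) = (P.elem z).map η := by
    intro T z
    rw [← Elem.res_res, hqs, ← Presheaf.map_elem]
  refine ⟨Q, s, hs, fun T s' => ?_, ?_⟩
  · obtain ⟨T', p, b, hp, hb, h⟩ := exists_basic_of_isLocallySurjective
      (hS := hS.toIsClassOfSmallMaps) (hC := hC) (hB := hB) η s'
    refine ⟨T', p, b, hp, hb, fun U t f hf hm => ?_⟩
    obtain ⟨V, r, z, hr, hz⟩ := h t f hf hm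
    exact hs.exists_res_eq hF' hr (z ≫ q) ((key z).trans hz)
  · obtain ⟨V, r, x, hr, hx⟩ := exists_cover_lift q hq (pullback.fst s.ob C.cod)
    have hob : q ≫ s.ob = P.σ := by
      have := congrArg Elem.ob hqs
      simpa using this
    have hc : (x ≫ 𝟙 P.X) ≫ P.σ = (r ≫ pullback.snd s.ob C.cod) ≫ C.cod := by
      rw [Category.comp_id, ← hob, reassoc_of% hx, pullback.condition, Category.assoc]
    refine hs.exists_res_eq hF' hr (P.res _ _ hc ≫ q) ?_
    have hx' : (r ≫ pullback.snd s.ob C.cod) ≫ C.cod = x ≫ ((P.elem (𝟙 P.X)).map η).ob :=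
      hc.symm.trans (Category.assoc _ _ _)
    rw [key, Elem.pull_res]
    exact (congrArg (Elem.map η) (P.elem_pull (𝟙 P.X) x _ hx').symm).trans
      ((Elem.map_pull η _ x _ hx').symm.trans ((Elem.pull_congr hqs.symm rfl rfl hx').trans
        ((Elem.res_pull s q x _ _).trans (Elem.pull_congr rfl hx rfl _))))

variable {hS' : IsClassOfSmallMaps S} {hC : S C.cod} {hB : J.IsPresentation B}
  {F : (Tot C)ᵒᵖ ⥤ Type (max u v)} (hF : Presieve.IsSheaf (siteTopology hS' hC hB) F)

include hF

/-- If a family consists of amalgamations of matching families of elements of a monic family on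
basic sieves, then its kernel is bounded: two of its members are equal precisely when the matching
families agree on the intersection of the sieves. -/
theorem Elem.isBounded_res_eq {Q G N : E} {s : Elem F Q} (hs : s.IsMonic) {β : G ⟶ B.K}
    {f : N ⟶ C.mor} {m : N ⟶ G} {x : N ⟶ Q} (hm : S m) (hM : B.IsMembers β f m) (γ : Elem F G)
    (hγ : γ.ob = β ≫ B.base) (hf : f ≫ C.cod = m ≫ γ.ob) (hx : γ.pull m f hf = s.res x) :
    IsBounded S fun U (t : U ⟶ G ⨯ G) => γ.res (t ≫ prod.fst) = γ.res (t ≫ prod.snd) := by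
  -- The domain of `ι` is the object of pairs of members, one of each sieve, with the same arrow.
  let n₁ := pullback.fst (prod.fst : G ⨯ G ⟶ G) m
  let e₁ := pullback.snd (prod.fst : G ⨯ G ⟶ G) m
  have h₁ : n₁ ≫ prod.fst = e₁ ≫ m := pullback.condition
  let n₂ := pullback.fst (n₁ ≫ prod.snd) m
  let e₂ := pullback.snd (n₁ ≫ prod.snd) m
  have h₂ : n₂ ≫ n₁ ≫ prod.snd = e₂ ≫ m := pullback.condition
  let ι := equalizer.ι (n₂ ≫ e₁ ≫ f) (e₂ ≫ f)
  have hι : ι ≫ n₂ ≫ e₁ ≫ f = ι ≫ e₂ ≫ f := equalizer.condition _ _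
  have hsmall : S (ι ≫ n₂ ≫ n₁) := hS'.composition _ _ (hS'.equalizer_ι _ _)
    (hS'.composition _ _ (hS'.pullback_fst _ _ hm) (hS'.pullback_fst _ _ hm))
  have hfx : ∀ ⦃U : E⦄ (k : U ⟶ N) (t : U ⟶ G) (g : U ⟶ C.mor) (hg : g ≫ C.cod = t ≫ γ.ob),
      k ≫ m = t → k ≫ f = g → γ.pull t g hg = s.res (k ≫ x) := by
    rintro U k _ _ hg rfl rfl
    rw [← res_res, ← hx, pull_res]
  refine (((IsBounded.eq hS' (ι ≫ n₂ ≫ e₁ ≫ x) (ι ≫ e₂ ≫ x)).all hS' _ hsmall).and hS'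
    (IsBounded.eq hS' (prod.fst ≫ β ≫ B.base) (prod.snd ≫ β ≫ B.base))).congr fun U t => ⟨?_, ?_⟩
  · rintro ⟨h, hb⟩
    have hob : (γ.res (t ≫ prod.fst)).ob = (γ.res (t ≫ prod.snd)).ob := by
      simpa [hγ] using hb
    have M₁ := hM.pullback (t ≫ prod.fst)
    have M₂ := hM.pullback (t ≫ prod.snd)
    have b₁ : ((t ≫ prod.fst) ≫ β) ≫ B.base = (γ.res (t ≫ prod.fst)).ob := by simp [hγ]
    have b₂ : ((t ≫ prod.snd) ≫ β) ≫ B.base = (γ.res (t ≫ prod.fst)).ob := by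
      rw [hob]; simp [hγ]
    have c₁ := (B.isSieve.cod_eq _ _ M₁.mem).trans ((Category.assoc _ _ _).trans (_ ≫= b₁))
    have c₂ := (B.isSieve.cod_eq _ _ M₂.mem).trans ((Category.assoc _ _ _).trans (_ ≫= b₂))
    refine eq_of_isCovering hF hob ((siteTopology hS' hC hB).intersection_covering
      (isCovering_basic _ _ b₁ M₁ c₁)
      (isCovering_basic _ _ b₂ M₂ c₂)) fun W w g hg hmem => ?_
    have m₁ := (M₁.principalSieve_arrows (X := ⟨U, (γ.res (t ≫ prod.fst)).ob⟩) c₁ _).1 hmem.2.1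
    have m₂ := (M₂.principalSieve_arrows (X := ⟨U, (γ.res (t ≫ prod.fst)).ob⟩) c₂ _).1 hmem.2.2
    replace m₁ : Mem B.sieve g (w ≫ (t ≫ prod.fst) ≫ β) := m₁
    replace m₂ : Mem B.sieve g (w ≫ (t ≫ prod.snd) ≫ β) := m₂
    rw [← Category.assoc] at m₁ m₂
    obtain ⟨k₁, ⟨hk₁, hk₁'⟩, -⟩ := hM.existsUnique _ _ m₁
    obtain ⟨k₂, ⟨hk₂, hk₂'⟩, -⟩ := hM.existsUnique _ _ m₂
    -- A member of the intersection is a member `k₁` of one sieve and a member `k₂` of the other.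
    obtain ⟨l, hl₁, hl₂, hl₃⟩ : ∃ l, l ≫ ι ≫ n₂ ≫ n₁ = w ≫ t ∧ l ≫ ι ≫ n₂ ≫ e₁ = k₁ ∧
        l ≫ ι ≫ e₂ = k₂ := by
      have a₁ : pullback.lift (w ≫ t) k₁ (by rw [hk₁', Category.assoc]) ≫ n₁ = w ≫ t :=
        pullback.lift_fst _ _ _
      have a₂ : pullback.lift (w ≫ t) k₁ (by rw [hk₁', Category.assoc]) ≫ e₁ = k₁ :=
        pullback.lift_snd _ _ _
      have a₃ : pullback.lift (pullback.lift (w ≫ t) k₁ (by rw [hk₁', Category.assoc])) k₂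
          (by rw [reassoc_of% a₁, hk₂']) ≫ n₂ = _ := pullback.lift_fst _ _ _
      have a₄ : pullback.lift (pullback.lift (w ≫ t) k₁ (by rw [hk₁', Category.assoc])) k₂
          (by rw [reassoc_of% a₁, hk₂']) ≫ e₂ = k₂ := pullback.lift_snd _ _ _
      have a₅ := equalizer.lift_ι (f := n₂ ≫ e₁ ≫ f) (g := e₂ ≫ f) _
        (by rw [reassoc_of% a₃, reassoc_of% a₂, reassoc_of% a₄, hk₁, hk₂])
      exact ⟨_, by rw [reassoc_of% a₅, reassoc_of% a₃, a₁],
        by rw [reassoc_of% a₅, reassoc_of% a₃, a₂], by rw [reassoc_of% a₅, a₄]⟩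
    have h3 := h w l hl₁
    rw [reassoc_of% hl₂, reassoc_of% hl₃] at h3
    refine (res_pull γ _ w g hg).trans (Eq.trans ?_ (res_pull γ _ w g (hg.trans (w ≫= hob))).symm)
    rw [hfx k₁ _ _ _ hk₁' hk₁, hfx k₂ _ _ _ hk₂' hk₂, h3]
  · intro h
    refine ⟨fun V r z hz => hs _ _ ?_, by simpa [hγ] using congrArg Elem.ob h⟩
    have h3 := congrArg (fun s : Elem F U => s.res r) h
    have hb : f ≫ C.cod = m ≫ β ≫ B.base := by rw [hf, hγ]
    have hz₁ : z ≫ ι ≫ n₂ ≫ e₁ ≫ m = r ≫ t ≫ prod.fst := by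
      rw [← h₁]; simpa using hz =≫ prod.fst
    have hz₂ : z ≫ ι ≫ e₂ ≫ m = r ≫ t ≫ prod.snd := by
      rw [← h₂]; simpa using hz =≫ prod.snd
    have hg₁ : (z ≫ ι ≫ e₂ ≫ f) ≫ C.cod = (r ≫ t ≫ prod.fst) ≫ γ.ob := by
      rw [← hι, ← hz₁]; simp [hf]
    have hg₂ : (z ≫ ι ≫ e₂ ≫ f) ≫ C.cod = (r ≫ t ≫ prod.snd) ≫ γ.ob := by
      rw [← hz₂]; simp [hf]
    have p₁ := hfx (z ≫ ι ≫ n₂ ≫ e₁) _ _ hg₁ (by simpa using hz₁) (by simp [hι])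
    have p₂ := hfx (z ≫ ι ≫ e₂) _ _ hg₂ (by simpa using hz₂) (by simp)
    simp only [Category.assoc] at p₁ p₂
    rw [← p₁, ← p₂]
    simp only [res_res] at h3
    have q₁ := res_pull γ (r ≫ t ≫ prod.fst) (𝟙 V) (z ≫ ι ≫ e₂ ≫ f) (by simpa using hg₁)
    have q₂ := res_pull γ (r ≫ t ≫ prod.snd) (𝟙 V) (z ≫ ι ≫ e₂ ≫ f) (by simpa using hg₂)
    refine (pull_congr rfl (Category.id_comp _).symm rfl _).trans (q₁.symm.trans
      ((pull_congr h3 rfl rfl _).trans (q₂.trans (pull_congr rfl (Category.id_comp _) rfl _))))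

/-- A sheaf with a monic generating family that is closed under the action has a universal family:
its elements are the amalgamations of matching families of generators on basic sieves. -/
theorem Elem.exists_isUniversal (hS : IsPredicative S) {Q : E} {s : Elem F Q} (hs : s.IsMonic)
    (hgen : s.IsGenerating B) (α : pullback s.ob C.cod ⟶ Q) (hα : s.res α =
        s.pull (pullback.fst _ _) (pullback.snd _ _) pullback.condition.symm) :
    ∃ (Y : E) (y : Elem F Y), y.IsUniversal := by
  -- The laws of an internal presheaf hold for `P`, but only the data matter for matching families.
  let P : PresheafData C := ⟨Q, s.ob, α⟩
  have hP : ∀ ⦃T : E⦄ (x : T ⟶ Q) (f : T ⟶ C.mor) (h : x ≫ s.ob = f ≫ C.cod),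
      s.res (P.res x f h) = s.pull x f h.symm := by
    intro T x f h
    refine (res_res s α _).symm.trans ?_
    rw [hα, pull_res]
    exact pull_congr rfl (pullback.lift_fst _ _ _) (pullback.lift_snd _ _ _) _
  obtain ⟨G, N, β, f, m, x, hm, hM, hx, huniv⟩ := P.exists_object_of_matching hS B
  obtain ⟨γ, hγ, hγx⟩ := exists_amalgamation hF β hM (s.res x) hx.σ_eq
    fun U y y' g hg hg' h1 h2 => by
      refine (res_pull s x y g hg).trans ?_
      rw [res_res, hx.matching y y' g hg' h1 h2]
      exact (hP _ _ _).symm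
  have hf : f ≫ C.cod = m ≫ γ.ob := by
    rw [hγ, B.isSieve.cod_eq _ _ hM.mem, Category.assoc]
  replace hγx := hγx hf
  have hF' := isCoverSheaf hF
  obtain ⟨Y, q, y, hq, hqy, hy⟩ := exists_quotient hF' hS γ
    (isBounded_res_eq hF hs hm hM γ hγ hf hγx)
  refine ⟨Y, y, fun T s' => ?_⟩
  -- Uniqueness holds because `y` is monic. For existence, the family of restrictions of `s'` to the
  -- members of a basic sieve is a matching family, hence classified by a map `g` to `G`.
  suffices ∃ z, y.res z = s' by
    obtain ⟨z, hz⟩ := this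
    exact ⟨z, hz, fun z' hz' => hy _ _ (hz'.trans hz.symm)⟩
  obtain ⟨T', p, b, hp, hb, h⟩ := hgen s'
  obtain ⟨M, f', m', -, hM'⟩ := B.exists_members hS' b
  have hf' : f' ≫ C.cod = (m' ≫ p) ≫ s'.ob := by
    rw [B.isSieve.cod_eq _ _ hM'.mem, Category.assoc, hb, Category.assoc]
  obtain ⟨x', hx'⟩ := h m' f' hf' hM'.mem
  have hx'σ : x' ≫ s.ob = f' ≫ C.dom := congrArg Elem.ob hx'
  have hmatch : P.IsMatching f' m' x' := by
    refine ⟨hx'σ, fun U k k' l hl h1 h2 => hs _ _ (Eq.trans ?_ (hP _ _ _).symm)⟩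
    have hl' : l ≫ C.cod = k ≫ f' ≫ C.dom := by rw [← hl, Category.assoc]
    have hl'' : l ≫ C.cod = k ≫ (s.res x').ob := hl'.trans (k ≫= hx'σ.symm)
    exact (res_res s x' k').symm.trans ((congrArg (fun s => Elem.res s k') hx').trans
      ((pull_res s' _ _ _ k').trans ((pull_congr rfl
        (by rw [← Category.assoc, ← h1, Category.assoc]) h2 _).trans
        ((pull_pull s' (m' ≫ p) f' hf' k l hl').symm.trans
        ((pull_congr hx'.symm rfl rfl _).trans (res_pull s x' k l hl''))))))
  obtain ⟨g, hg, hgx⟩ := huniv b f' m' x' hM' hmatch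
  refine hy.exists_res_eq hF' hp (g ≫ q) ?_
  rw [← res_res, hqy]
  have hgb : b ≫ B.base = (γ.res g).ob := by rw [res_ob, hγ, reassoc_of% hg]
  refine eq_of_basic hF b hgb (hgb.symm.trans hb) fun U t l hl hmem => ?_
  obtain ⟨k, ⟨hk1, hk2⟩, -⟩ := hM'.existsUnique _ _ hmem
  have hmem' := hmem
  rw [← hg, ← Category.assoc] at hmem'
  obtain ⟨k', ⟨hk'1, hk'2⟩, -⟩ := hM.existsUnique _ _ hmem'
  have e := hgx k k' (by rw [hk'2, reassoc_of% hk2]) (by rw [hk'1, hk1])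
  refine (res_pull γ g t l hl).trans (Eq.trans (Eq.trans (b := s.res (k ≫ x')) ?_ ?_)
    (res_pull s' p t l (hl.trans (t ≫= hgb.symm.trans hb))).symm)
  · rw [← e, ← res_res, ← hγx, pull_res]
    exact pull_congr rfl hk'2.symm hk'1.symm _
  · rw [← res_res, hx', pull_res]
    exact pull_congr rfl (by rw [reassoc_of% hk2]) hk1 _

end Generators

/-! ### Sheafification -/

section Sheafification

open Opposite

variable {E : Type u} [Category.{v} E] [PositiveHeytingCategory E] {S : MorphismProperty E}
  {C : InternalCategory E} {J : Topology S C} {B : ObjectOfSieves S C}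

/-- The sheaf on the total category associated to an internal presheaf is the presheaf of elements
of an internal presheaf. -/
theorem exists_ext_iso_sheafify (hS : IsPredicative S) (hC : S C.cod) (hB : J.IsPresentation B)
    (P : Presheaf C) :
    ∃ P' : Presheaf C, Nonempty
      (P'.ext ≅ CategoryTheory.sheafify (siteTopology hS.toIsClassOfSmallMaps hC hB) P.ext) := by
  let K := siteTopology hS.toIsClassOfSmallMaps hC hB
  have hF : Presieve.IsSheaf K (CategoryTheory.sheafify K P.ext) :=
    (isSheaf_iff_isSheaf_of_type _ _).1 ((presheafToSheaf K _).obj P.ext).property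
  have : CategoryTheory.Presheaf.IsLocallyInjective K (toSheafify K P.ext) := inferInstance
  have : CategoryTheory.Presheaf.IsLocallySurjective K (toSheafify K P.ext) := inferInstance
  obtain ⟨Q, s, hs, hgen, α, hα⟩ := exists_isMonic_isGenerating hS hF (toSheafify K P.ext)
  obtain ⟨Y, y, hy⟩ := Elem.exists_isUniversal hF hS hs hgen α hα
  exact hy.exists_presheaf

variable (J) in
/-- Internal sheaves as sheaves on the total category. -/
def extSheafFunctor (hS : IsClassOfSmallMaps S) (hC : S C.cod) (hB : J.IsPresentation B) :
    J.Sheaf ⥤ CategoryTheory.Sheaf (siteTopology hS hC hB) (Type (max u v)) :=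
  ObjectProperty.lift _ (J.inclusion ⋙ Presheaf.extFunctor C) fun P =>
    (isSheaf_iff_isSheaf_of_type _ _).2 (isSheaf_ext_of_isSheaf hS hC hB P.obj P.property)

/-- Sheafification over the total category restricts to internal presheaves, along the fully
faithful functors from internal presheaves and sheaves to those over the total category. The restriction is
left exact, because these functors preserve and reflect finite limits. -/
theorem exists_sheafification (hS : IsPredicative S) (hC : S C.cod) (hB : J.IsPresentation B) :
    HasFiniteLimits J.Sheaf ∧ ∃ L : Presheaf C ⥤ J.Sheaf,
      Nonempty (L ⊣ J.inclusion) ∧ PreservesFiniteLimits L := by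
  obtain ⟨h1, h2⟩ := Presheaf.hasFiniteLimits_and_preserves (C := C)
  let K := siteTopology hS.toIsClassOfSmallMaps hC hB
  let Ψ := extSheafFunctor J hS.toIsClassOfSmallMaps hC hB
  have hΨ : Ψ.FullyFaithful :=
    Functor.FullyFaithful.ofCompFaithful (G := sheafToPresheaf K (Type (max u v)))
      ((ObjectProperty.fullyFaithfulι _).comp (.ofFullyFaithful (Presheaf.extFunctor C)))
  have := hΨ.full
  have := hΨ.faithful
  have hmem : ∀ P : Presheaf C, Ψ.essImage ((presheafToSheaf K _).obj P.ext) := by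
    intro P
    obtain ⟨P', ⟨e⟩⟩ := exists_ext_iso_sheafify hS hC hB P
    have hP' : J.IsSheaf P' := isSheaf_of_isSheaf_ext hS.toIsClassOfSmallMaps hC hB P'
      (Presieve.isSheaf_iso K e.symm
        ((isSheaf_iff_isSheaf_of_type _ _).1 ((presheafToSheaf K _).obj P.ext).property))
    exact ⟨⟨P', hP'⟩, ⟨(fullyFaithfulSheafToPresheaf K _).preimageIso e⟩⟩
  let L : Presheaf C ⥤ J.Sheaf :=
    ObjectProperty.lift Ψ.essImage (Presheaf.extFunctor C ⋙ presheafToSheaf K _) hmem ⋙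
      Ψ.toEssImage.inv
  let e : Presheaf.extFunctor C ⋙ presheafToSheaf K _ ≅ L ⋙ Ψ :=
    (ObjectProperty.liftCompιIso Ψ.essImage _ hmem).symm ≪≫
      Functor.isoWhiskerLeft (ObjectProperty.lift Ψ.essImage _ hmem)
        ((Functor.leftUnitor _).symm ≪≫
          Functor.isoWhiskerRight Ψ.toEssImage.asEquivalence.counitIso.symm _ ≪≫
          Functor.associator _ _ _ ≪≫
          Functor.isoWhiskerLeft Ψ.toEssImage.inv Ψ.toEssImageCompι)
  have adj : L ⊣ J.inclusion :=
    (sheafificationAdjunction K (Type (max u v))).restrictFullyFaithful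
      (Functor.FullyFaithful.ofFullyFaithful (Presheaf.extFunctor C)) hΨ e (Iso.refl _)
  have : Reflective J.inclusion := ⟨L, adj⟩
  refine ⟨⟨fun D _ _ => hasLimitsOfShape_of_reflective J.inclusion⟩, L, ⟨adj⟩, ⟨fun D _ _ => ?_⟩⟩
  have : PreservesLimitsOfShape D (L ⋙ Ψ) := preservesLimitsOfShape_of_natIso e
  exact preservesLimitsOfShape_of_reflects_of_preserves L Ψ

end Sheafification

end AST

end

theorem mainTheorem8 {E : Type u} [Category.{v} E] [AST.PositiveHeytingCategory E]
    (S : MorphismProperty E) (hS : AST.IsPredicative S)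
    (C : AST.InternalCategory E) (hC : S C.cod)
    (J : AST.Topology S C) (hJ : J.Presentable) :
    HasFiniteLimits (AST.Presheaf C) ∧ HasFiniteLimits J.Sheaf ∧
      ∃ L : AST.Presheaf C ⥤ J.Sheaf,
        Nonempty (L ⊣ J.inclusion) ∧ PreservesFiniteLimits L := by
  obtain ⟨B, hB⟩ := hJ
  exact ⟨AST.Presheaf.hasFiniteLimits_and_preserves.1, AST.exists_sheafification hS hC hB⟩
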